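/- Let $\Omega\subset\mathbb R^2$ be a bounded open set with Lipschitz boundary and outward normal $\vec n$, let $\omega\subset\Omega$ be measurable, let $T,\nu,\mu,\lambda_0>0$, let $\lambda=\lambda_0$ on $\Omega\setminus\omega$ and $\lambda=0$ on $\omega$, and let $u_0\in L^2(\Omega)$. Let $\mathcal M(\mathbb R)$ be the space of finite signed Radon measures on $\mathbb R$, and let $L^1_w((0,T)\times\Omega;\mathcal M(\mathbb R))$ be the space of families $\pi=(\pi_{(t,x)})$ in $\mathcal M(\mathbb R)$ such that $(t,x)\mapsto\int_{\mathbb R} f\,d\pi_{(t,x)}$ is measurable for every $f\in C_0(\mathbb R)$ and $\int_0^T\int_\Omega |\pi_{(t,x)}|(\mathbb R)\,dx\,dt<\infty$. A pair $(u,\pi)$ with $u\in L^2((0,T);H^2(\Omega))$ and $\pi\in L^1_w((0,T)\times\Omega;\mathcal M(\mathbb R))$ is called a solution of $$\partial_t u=\Delta\big(-\nu\arctan(\Delta u)|\nabla u|-\mu\Delta u\big)+\lambda(u_0-u)\ \text{ in }(0,T)\times\Omega,\qquad u|_{t=0}=u_0,\qquad u=\frac{\partial u}{\partial\vec n}=0\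 \text{ on }\partial\Omega,$$ if (i) for every $\varphi\in \mathrm{Lip}([0,T];H^2(\Omega))$ with $\varphi(t,\cdot)=\nabla\varphi(t,\cdot)\cdot\vec n=0$ on $\partial\Omega$ for all $t\in[0,T]$ (that is, $\varphi(t,\cdot)\in H^2_0(\Omega)$, the closure of $C_c^\infty(\Omega)$ in $H^2(\Omega)$) and $\varphi(T,\cdot)=0$, $$\int_0^T\!\!\int_\Omega u\,\partial_t\varphi\,dx\,dt+\int_\Omega u_0\,\varphi(0,\cdot)\,dx=\int_0^T\!\!\int_\Omega\Big(\nu\int_{\mathbb R}\arctan(\xi)\,d\pi_{(t,x)}(\xi)\,|\nabla u|+\mu\Delta u\Big)\Delta\varphi\,dx\,dt-\int_0^T\!\!\int_\Omega\lambda(u_0-u)\,\varphi\,dx\,dt;$$ (ii) the function $(t,x)\mapsto\int_{\mathbb R}\arctan(\xi)\,d\pi_{(t,x)}(\xi)$ is essentially bounded on $(0,T)\times\Omega$. **Theorem.** If $(u,\pi)$ is a solution, then $u_0$ is the weak initial trace of $u$: for every $\phi\in H^2(\Omega)$, $$\operatorname*{ess\,lim}_{t\to0^+}\int_\Omega u(t,x)\,\phi(x)\,dx=\int_\Omega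 u_0(x)\,\phi(x)\,dx .$$ -/

import Mathlib

open MeasureTheory Set Filter Topology
open scoped ENNReal NNReal ZeroAtInfty

namespace ShockFilterCH

/-- The Euclidean plane `ℝ²`. -/
abbrev Plane : Type := EuclideanSpace ℝ (Fin 2)

/-- A set `Ω ⊆ ℝ²` has Lipschitz boundary if near each boundary point it is, after a linear
isometry of the plane, the part of a ball that lies strictly above the graph of a Lipschitz
function. -/
def HasLipschitzBoundary (Ω : Set Plane) : Prop :=
  ∀ p ∈ frontier Ω, ∃ r > 0, ∃ (e : Plane ≃ₗᵢ[ℝ] Plane) (γ : ℝ → ℝ) (K : ℝ≥0),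
    LipschitzWith K γ ∧
      Ω ∩ Metric.ball p r = {x ∈ Metric.ball p r | γ (e x 0) < e x 1}

/-- Test functions on `Ω`: the elements of `C_c^∞(Ω)`. -/
def IsTestFunction (Ω : Set Plane) (ψ : Plane → ℝ) : Prop :=
  ContDiff ℝ ((⊤ : ℕ∞) : WithTop ℕ∞) ψ ∧ HasCompactSupport ψ ∧ tsupport ψ ⊆ Ω

/-- The classical partial derivative `∂ᵢψ`. -/
noncomputable def partialD (i : Fin 2) (ψ : Plane → ℝ) (x : Plane) : ℝ :=
  fderiv ℝ ψ x (EuclideanSpace.single i 1)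

/-- The Lebesgue space `L²(Ω)`. -/
abbrev L2 (Ω : Set Plane) : Type := Lp ℝ 2 (volume.restrict Ω)

/-- `g ∈ L²(Ω)` is the weak partial derivative `∂ᵢf` of `f ∈ L²(Ω)` in `Ω`. -/
def IsWeakPartial (Ω : Set Plane) (i : Fin 2) (f g : L2 Ω) : Prop :=
  ∀ ψ : Plane → ℝ, IsTestFunction Ω ψ →
    ∫ x in Ω, f x * partialD i ψ x = -∫ x in Ω, g x * ψ x

lemma IsTestFunction.memLp {Ω : Set Plane} {ψ : Plane → ℝ} (hψ : IsTestFunction Ω ψ) :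
    MemLp ψ 2 (volume.restrict Ω) :=
  (hψ.1.continuous.memLp_of_hasCompactSupport hψ.2.1).restrict Ω

lemma IsTestFunction.partialD_memLp {Ω : Set Plane} {ψ : Plane → ℝ} (hψ : IsTestFunction Ω ψ)
    (i : Fin 2) : MemLp (partialD i ψ) 2 (volume.restrict Ω) := by
  have hc : Continuous (partialD i ψ) :=
    (hψ.1.continuous_fderiv (by simp)).clm_apply continuous_const
  have hs : HasCompactSupport (partialD i ψ) :=
    hψ.2.1.fderiv_apply (𝕜 := ℝ) (EuclideanSpace.single i 1)
  exact (hc.memLp_of_hasCompactSupport hs).restrict Ω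

lemma isWeakPartial_zero (Ω : Set Plane) (i : Fin 2) : IsWeakPartial Ω i 0 0 := by
  intro ψ _
  have h : ∀ θ : Plane → ℝ, ∫ x in Ω, (0 : L2 Ω) x * θ x = 0 := fun θ => by
    refine integral_eq_zero_of_ae ?_
    filter_upwards [Lp.coeFn_zero ℝ 2 (volume.restrict Ω)] with x hx
    rw [hx]; simp
  rw [h, h, neg_zero]

lemma IsWeakPartial.add {Ω : Set Plane} {i : Fin 2} {f g f' g' : L2 Ω}
    (h : IsWeakPartial Ω i f g) (h' : IsWeakPartial Ω i f' g') :
    IsWeakPartial Ω i (f + f') (g + g') := by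
  intro ψ hψ
  have key : ∀ (a b : L2 Ω) (θ : Plane → ℝ), MemLp θ 2 (volume.restrict Ω) →
      ∫ x in Ω, (a + b) x * θ x = (∫ x in Ω, a x * θ x) + ∫ x in Ω, b x * θ x := by
    intro a b θ hθ
    have ha : Integrable (fun x => a x * θ x) (volume.restrict Ω) :=
      (Lp.memLp a).integrable_mul hθ
    have hb : Integrable (fun x => b x * θ x) (volume.restrict Ω) :=
      (Lp.memLp b).integrable_mul hθ
    rw [← integral_add ha hb]
    refine integral_congr_ae ?_
    filter_upwards [Lp.coeFn_add a b] with x hx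
    rw [hx, Pi.add_apply, add_mul]
  rw [key _ _ _ (hψ.partialD_memLp i), key _ _ _ hψ.memLp, h ψ hψ, h' ψ hψ]
  ring

lemma IsWeakPartial.smul {Ω : Set Plane} {i : Fin 2} {f g : L2 Ω} (c : ℝ)
    (h : IsWeakPartial Ω i f g) : IsWeakPartial Ω i (c • f) (c • g) := by
  intro ψ hψ
  have key : ∀ (a : L2 Ω) (θ : Plane → ℝ),
      ∫ x in Ω, (c • a) x * θ x = c * ∫ x in Ω, a x * θ x := by
    intro a θ
    rw [← integral_const_mul]
    refine integral_congr_ae ?_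
    filter_upwards [Lp.coeFn_smul c a] with x hx
    rw [hx, Pi.smul_apply, smul_eq_mul, mul_assoc]
  rw [key, key, h ψ hψ]
  ring

/-- Index set of the components of a second order jet `(v, (∂ᵢv)ᵢ, (∂ⱼ∂ᵢv)ᵢⱼ)`. -/
abbrev JetIndex : Type := Unit ⊕ Fin 2 ⊕ (Fin 2 × Fin 2)

/-- The Sobolev space `H²(Ω)`, realised as the subspace of those jets
`(v, (∂ᵢv)ᵢ, (∂ⱼ∂ᵢv)ᵢⱼ)` of `L²(Ω)` functions whose components are the weak derivatives of `v`.
The norm is `‖v‖² = ‖v‖²_{L²} + ∑ᵢ ‖∂ᵢv‖²_{L²} + ∑ᵢⱼ ‖∂ⱼ∂ᵢv‖²_{L²}`. -/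
def H2 (Ω : Set Plane) : Submodule ℝ (PiLp 2 (fun _ : JetIndex => L2 Ω)) where
  carrier := {J |
    (∀ i, IsWeakPartial Ω i (J (Sum.inl ())) (J (Sum.inr (Sum.inl i)))) ∧
    ∀ i j, IsWeakPartial Ω j (J (Sum.inr (Sum.inl i))) (J (Sum.inr (Sum.inr (i, j))))}
  zero_mem' := ⟨fun i => isWeakPartial_zero Ω i, fun _ j => isWeakPartial_zero Ω j⟩
  add_mem' := fun hJ hJ' =>
    ⟨fun i => (hJ.1 i).add (hJ'.1 i), fun i j => (hJ.2 i j).add (hJ'.2 i j)⟩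
  smul_mem' := fun c _ hJ => ⟨fun i => (hJ.1 i).smul c, fun i j => (hJ.2 i j).smul c⟩

namespace H2

variable {Ω : Set Plane}

/-- The underlying function of an element of `H²(Ω)`. -/
def fn (v : H2 Ω) : L2 Ω := v.1 (Sum.inl ())

/-- The weak partial derivative `∂ᵢv`. -/
def grad (v : H2 Ω) (i : Fin 2) : L2 Ω := v.1 (Sum.inr (Sum.inl i))

/-- The weak second partial derivative `∂ⱼ∂ᵢv`. -/
def hess (v : H2 Ω) (i j : Fin 2) : L2 Ω := v.1 (Sum.inr (Sum.inr (i, j)))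

/-- The Euclidean length `|∇v(x)|` of the weak gradient. -/
noncomputable def gradNorm (v : H2 Ω) (x : Plane) : ℝ :=
  Real.sqrt ((grad v 0 x) ^ 2 + (grad v 1 x) ^ 2)

/-- The weak Laplacian `Δv = ∂₀∂₀v + ∂₁∂₁v`. -/
noncomputable def lap (v : H2 Ω) : L2 Ω := hess v 0 0 + hess v 1 1

end H2

/-- `H²₀(Ω)`, the closure of `C_c^∞(Ω)` in `H²(Ω)`: the functions in `H²(Ω)` with
`v = 0` and `∇v · n = 0` on `∂Ω`. -/
def H20 (Ω : Set Plane) : Set (H2 Ω) :=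
  closure {v : H2 Ω | ∃ ψ : Plane → ℝ, IsTestFunction Ω ψ ∧ H2.fn v =ᵐ[volume.restrict Ω] ψ}

/-- The fidelity coefficient: `0` on the inpainting domain `ω` and `lam0` outside of it. -/
noncomputable def fidelity (lam0 : ℝ) (ω : Set Plane) (x : Plane) : ℝ :=
  open Classical in if x ∈ ω then 0 else lam0

/-- The space `L¹_w((0,T) × Ω; 𝓜(ℝ))`: families of finite signed Radon measures on `ℝ` that are
measurable for the weak topology of `𝓜(ℝ) = C₀(ℝ)'` and whose total mass is integrable. -/
def IsL1WeakMeasureFamily (Ω : Set Plane) (T : ℝ) (π : ℝ × Plane → SignedMeasure ℝ) : Prop :=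
  (∀ f : C₀(ℝ, ℝ), AEStronglyMeasurable (fun z => ∫ᵛ ξ, f ξ ∂•(π z))
    (volume.restrict (Ioo 0 T ×ˢ Ω))) ∧
  ∫⁻ z in Ioo 0 T ×ˢ Ω, (π z).totalVariation univ ≠ ∞

/-- The function `(t,x) ↦ ∫_ℝ arctan(ξ) dπ_{(t,x)}(ξ)`. -/
noncomputable def arctanMean (π : ℝ × Plane → SignedMeasure ℝ) (z : ℝ × Plane) : ℝ :=
  ∫ᵛ ξ, Real.arctan ξ ∂•(π z)

/-- Admissible test functions: `φ ∈ Lip([0,T]; H²(Ω))` with `φ = ∇φ · n = 0` on `[0,T] × ∂Ω` and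
`φ(T, ·) = 0`. -/
def IsAdmissibleTest (Ω : Set Plane) (T : ℝ) (φ : ℝ → H2 Ω) : Prop :=
  (∃ K : ℝ≥0, LipschitzOnWith K φ (Icc 0 T)) ∧ (∀ t ∈ Icc 0 T, φ t ∈ H20 Ω) ∧ φ T = 0

/-- Solutions `(u, π)` of the initial-boundary value problem for the shock filter Cahn-Hilliard
equation `∂ₜu = Δ(-ν arctan(Δu)|∇u| - μ Δu) + λ (u₀ - u)` with initial datum `u₀`. -/
structure IsYoungSolution (Ω ω : Set Plane) (T ν μ lam0 : ℝ) (u₀ : L2 Ω)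
    (u : ℝ → H2 Ω) (π : ℝ × Plane → SignedMeasure ℝ) : Prop where
  /-- `u ∈ L²((0,T); H²(Ω))`. -/
  memLp : MemLp u 2 (volume.restrict (Ioo 0 T))
  /-- `π ∈ L¹_w((0,T) × Ω; 𝓜(ℝ))`. -/
  young : IsL1WeakMeasureFamily Ω T π
  /-- The variational formulation. -/
  weak_form : ∀ φ : ℝ → H2 Ω, IsAdmissibleTest Ω T φ →
    (∫ t in Ioo 0 T, ∫ x in Ω, H2.fn (u t) x * H2.fn (deriv φ t) x)
        + ∫ x in Ω, u₀ x * H2.fn (φ 0) x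
      = (∫ t in Ioo 0 T, ∫ x in Ω,
          (ν * arctanMean π (t, x) * H2.gradNorm (u t) x + μ * H2.lap (u t) x) * H2.lap (φ t) x)
        - ∫ t in Ioo 0 T, ∫ x in Ω,
            fidelity lam0 ω x * (u₀ x - H2.fn (u t) x) * H2.fn (φ t) x
  /-- `(t,x) ↦ ∫ arctan dπ_{(t,x)}` is essentially bounded. -/
  arctan_bound : ∃ c : ℝ, ∀ᵐ z ∂(volume.restrict (Ioo 0 T ×ˢ Ω)), |arctanMean π z| ≤ c

/-- `ess lim_{t → 0⁺} F(t) = L`: for each neighbourhood `U` of `L` there is `δ > 0` such that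
`F(t) ∈ U` for almost every `t ∈ (0,δ)`. -/
def EssLimAtZero (F : ℝ → ℝ) (L : ℝ) : Prop :=
  Tendsto F (𝓝[>] 0 ⊓ ae volume) (𝓝 L)

end ShockFilterCH

/-! For a test function `ψ` in `C_c^∞(Ω)` the claim is immediate: testing the equation with
functions of `t` times `ψ` shows that `∫ u(t) ψ` is a.e. equal to `∫ u₀ ψ - ∫₀ᵗ G`, with `|G| ≤ C
‖ψ‖_{H²} (‖u(t)‖_{H²} + 1)` (`IsYoungSolution.exists_primitive`). The difficulty is that a general
`φ` in `H²(Ω)` does not vanish at the boundary, so test functions `ψ_n` approximating it in `L²` may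
have unbounded `H²` norms.

The remedy is interpolation in time. Suppose `‖ψ_n‖_{H²} ≲ 64^n`, while `|∫ v (ψ_n - ψ_{n+1})| ≲
256^{-n} ‖v‖_{H²}` for all `v` in `H²(Ω)`. Since `‖u(t)‖_{H²}` is square integrable in time, the
function `t ↦ ∫ u(t)(ψ_n - ψ_{n+1})` has size `256^{-n}` and derivative of size `64^n`, both in
`L²(0,T)`. Its supremum is therefore of order `√(256^{-n} 64^n) = 2^{-n}`, which is summable. The
limit is uniform up to `t = 0`, where the values are `∫ u₀ ψ_n` (`abs_primitive_le`,
`essLimAtZero_of_approx`).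

To build `ψ_n` (`exists_approx`), `φ` is cut off near a boundary point, extended by zero to `f`, and
convolved at scale `ε ~ 16^{-n}` with a kernel supported in a cone pointing into `Ω`, so that the
support moves inside. The kernel is chosen with its dilation difference equal to a sum of pure
second derivatives (`exists_kernel`); these pass to `v` and give the factor `ε² ~ 256^{-n}`.
Although `f` may jump across the boundary, it keeps half a derivative in `L²` (`shiftSq_le_norm`),
so second derivatives of `ψ_n` cost `ε^{-3/2} ~ 64^n` and not `ε^{-2} ~ 256^n`; with the latter the
interpolation would give no decay. A partition of unity and the cone condition for Lipschitz domains
assemble the local results. -/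

namespace ShockFilterCH

/-! ### Interpolation in time and passage to the limit -/

section

/-- Cauchy–Schwarz on a subinterval of `(0,T)`. -/
lemma setIntegral_Ioc_le_sqrt_mul {T : ℝ} {g : ℝ → ℝ}
    (hg : MemLp g 2 (volume.restrict (Ioc 0 T))) {x τ : ℝ} (hx : 0 ≤ x) (hτ : 0 ≤ τ)
    (hxT : x + τ ≤ T) :
    ∫ s in Ioc x (x + τ), |g s| ≤ √τ * √(∫ s in Ioc 0 T, g s ^ 2) := by
  have hsub : Ioc x (x + τ) ⊆ Ioc 0 T := fun s hs => ⟨hx.trans_lt hs.1, hs.2.trans hxT⟩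
  have hg' : MemLp g 2 (volume.restrict (Ioc x (x + τ))) :=
    hg.mono_measure (Measure.restrict_mono hsub le_rfl)
  have h1 : MemLp (fun _ : ℝ => (1 : ℝ)) 2 (volume.restrict (Ioc x (x + τ))) :=
    memLp_const _
  have key := integral_mul_le_Lp_mul_Lq_of_nonneg (μ := volume.restrict (Ioc x (x + τ)))
    (p := 2) (q := 2) Real.HolderConjugate.two_two (f := fun _ => (1 : ℝ)) (g := fun s => |g s|)
    (ae_of_all _ fun _ => zero_le_one) (ae_of_all _ fun _ => abs_nonneg _)
    (by simpa using h1) (by simpa using hg'.norm)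
  simp only [one_mul, Real.rpow_two, one_pow, sq_abs, ← Real.sqrt_eq_rpow] at key
  refine key.trans ?_
  have hc : ∫ _ in Ioc x (x + τ), (1 : ℝ) = τ := by simp [hτ]
  rw [hc]
  gcongr
  · exact ae_of_all _ fun _ => sq_nonneg _
  · exact hg.integrable_sq

/-- Interpolation in time: a function with small `L²` size and controlled derivative is
uniformly small. -/
lemma abs_primitive_le {T : ℝ} {g H D : ℝ → ℝ} {A B d : ℝ} (hA : 0 ≤ A) (hB : 0 ≤ B)
    (hg : MemLp g 2 (volume.restrict (Ioc 0 T)))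
    (hH : IntegrableOn H (Ioc 0 T))
    (hHg : ∀ᵐ t ∂volume.restrict (Ioc 0 T), |H t| ≤ B * |g t|)
    (hD : ∀ t ∈ Icc 0 T, D t = d - ∫ s in Ioc 0 t, H s)
    (hDg : ∀ᵐ t ∂volume.restrict (Ioc 0 T), |D t| ≤ A * |g t|)
    {τ : ℝ} (hτ : 0 < τ) (hτT : τ ≤ T) {t : ℝ} (ht : t ∈ Icc 0 T) :
    |D t| ≤ (A / √τ + B * √τ) * √(∫ s in Ioc 0 T, g s ^ 2) := by
  set G := √(∫ s in Ioc 0 T, g s ^ 2)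
  -- A window of length `τ` around `t` that stays in `[0,T]`: to the right of `t` if there is room,
  -- otherwise the last one.
  obtain ⟨x, hx0, hxT, hxt, htx⟩ : ∃ x, 0 ≤ x ∧ x + τ ≤ T ∧ x ≤ t ∧ t ≤ x + τ := by
    rcases le_total t (T - τ) with h | h
    · exact ⟨t, ht.1, by linarith, le_rfl, by linarith⟩
    · exact ⟨T - τ, by linarith, by linarith, h, by linarith [ht.2]⟩
  set I := Ioc x (x + τ)
  have hsub : I ⊆ Ioc 0 T := fun s hs => ⟨hx0.trans_lt hs.1, hs.2.trans hxT⟩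
  have hμ : volume.restrict I ≤ volume.restrict (Ioc 0 T) := Measure.restrict_mono hsub le_rfl
  have hgI : IntegrableOn (fun s => |g s|) I :=
    ((hg.mono_measure hμ).integrable (by norm_num)).abs
  have hCS : ∫ s in I, |g s| ≤ √τ * G := setIntegral_Ioc_le_sqrt_mul hg hx0 hτ.le hxT
  have hHI : IntegrableOn H I := hH.mono_set hsub
  have hHint : ∫ s in I, |H s| ≤ B * ∫ s in I, |g s| := by
    rw [← integral_const_mul]
    exact integral_mono_ae hHI.abs (hgI.const_mul B) (ae_mono hμ hHg)
  have hdiff : ∀ s ∈ I, |D t| ≤ |D s| + ∫ r in I, |H r| := by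
    intro s hs
    have hii : ∀ y, 0 ≤ y → y ≤ T → ∫ r in Ioc 0 y, H r = ∫ r in (0 : ℝ)..y, H r := fun y hy _ =>
      (intervalIntegral.integral_of_le hy).symm
    have hint : ∀ y, 0 ≤ y → y ≤ T → IntervalIntegrable H volume 0 y := fun y hy hyT =>
      (intervalIntegrable_iff_integrableOn_Ioc_of_le hy).2
        (hH.mono_set (Ioc_subset_Ioc_right hyT))
    have hs0 := (hsub hs).1.le
    have hsT := (hsub hs).2
    have e : D t - D s = - ∫ r in s..t, H r := by
      rw [hD t ht, hD s ⟨hs0, hsT⟩, hii t ht.1 ht.2, hii s hs0 hsT,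
        ← intervalIntegral.integral_interval_sub_left (hint t ht.1 ht.2) (hint s hs0 hsT)]
      ring
    have e2 : |∫ r in s..t, H r| ≤ ∫ r in I, |H r| := by
      have := intervalIntegral.norm_integral_le_integral_norm_uIoc (f := H) (a := s) (b := t)
        (μ := volume)
      refine this.trans (setIntegral_mono_set hHI.abs (ae_of_all _ fun _ => abs_nonneg _) ?_)
      refine LE.le.eventuallyLE fun r hr => ?_
      rw [uIoc, mem_Ioc] at hr
      exact ⟨(le_min hs.1.le hxt).trans_lt hr.1, hr.2.trans (max_le hs.2 htx)⟩
    calc |D t| = |D s + (D t - D s)| := by ring_nf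
      _ ≤ |D s| + |D t - D s| := abs_add_le _ _
      _ ≤ _ := by rw [e, abs_neg]; gcongr
  have hae : ∀ᵐ s ∂volume.restrict I, |D t| ≤ A * |g s| + B * (√τ * G) := by
    filter_upwards [ae_mono hμ hDg, ae_restrict_mem measurableSet_Ioc] with s hs hsI
    refine (hdiff s hsI).trans (add_le_add hs (hHint.trans ?_))
    gcongr
  -- The pointwise bound on `D s` holds only up to the integrable weight `g s`, so it is averaged
  -- over the window.
  have hfin : τ * |D t| ≤ A * (√τ * G) + τ * (B * (√τ * G)) := by
    have h1 : ∫ _ in I, |D t| ≤ ∫ s in I, (A * |g s| + B * (√τ * G)) :=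
      integral_mono_ae (integrable_const _) ((hgI.const_mul A).add (integrable_const _)) hae
    rw [integral_add (hgI.const_mul A) (integrable_const _), integral_const_mul] at h1
    have hc : ∀ c : ℝ, ∫ _ in I, c = τ * c := fun c => by simp [I, hτ.le]
    rw [hc, hc] at h1
    refine h1.trans ?_
    gcongr
  have hsq : √τ * √τ = τ := Real.mul_self_sqrt hτ.le
  have hpos : 0 < √τ := Real.sqrt_pos.2 hτ
  have : |D t| ≤ (A * (√τ * G) + τ * (B * (√τ * G))) / τ := by
    rw [le_div_iff₀ hτ]; linarith
  refine this.trans (le_of_eq ?_)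
  generalize √τ = q at *
  rw [← hsq]
  field_simp

/-- A sequence of absolutely continuous approximations whose increments are small in `L²` but
whose derivatives may blow up at a slower rate: the limit has the expected essential limit. -/
lemma essLimAtZero_of_approx {T : ℝ} (hT : 0 < T) {g : ℝ → ℝ} {M G : ℕ → ℝ → ℝ} {F : ℝ → ℝ}
    {c : ℕ → ℝ} {L C : ℝ} (hC : 0 ≤ C)
    (hg : MemLp g 2 (volume.restrict (Ioc 0 T)))
    (hG : ∀ n, IntegrableOn (G n) (Ioc 0 T))
    (hGg : ∀ n, ∀ᵐ t ∂volume.restrict (Ioc 0 T), |G n t| ≤ C * 64 ^ n * |g t|)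
    (hM : ∀ n, ∀ᵐ t ∂volume.restrict (Ioc 0 T), M n t = c n - ∫ s in Ioc 0 t, G n s)
    (hMg : ∀ n, ∀ᵐ t ∂volume.restrict (Ioc 0 T),
      |M n t - M (n + 1) t| ≤ C * (1 / 256) ^ n * |g t|)
    (hMF : ∀ᵐ t ∂volume.restrict (Ioc 0 T), Tendsto (fun n => M n t) atTop (𝓝 (F t)))
    (hc : Tendsto c atTop (𝓝 L)) :
    EssLimAtZero F L := by
  -- The continuous representative of `M n`; unlike `M n` it has a meaningful value at `t = 0`,
  -- namely `c n`.
  set N : ℕ → ℝ → ℝ := fun n t => c n - ∫ s in Ioc 0 t, G n s with hN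
  set Γ := √(∫ s in Ioc 0 T, g s ^ 2)
  obtain ⟨K, hK⟩ : ∃ K : ℝ, ∀ n, ∀ t ∈ Icc 0 T, dist (N n t) (N (n + 1) t) ≤ K / 2 / 2 ^ n := by
    refine ⟨(C / √T + 65 * C * √T) * Γ * 2, fun n t ht => ?_⟩
    -- With `√τ` of order `128^{-n}`, both `256^{-n} / √τ` and `64^n √τ` are of order `2^{-n}`. In
    -- `B` below, `65 = 1 + 64` collects the bounds for `G n` and `G (n + 1)`.
    have hτ : (0 : ℝ) < T * ((1 / 128) ^ n) ^ 2 := by positivity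
    have hτT : T * ((1 / 128) ^ n) ^ 2 ≤ T := by
      have : ((1 / 128 : ℝ) ^ n) ^ 2 ≤ 1 :=
        pow_le_one₀ (by positivity) (pow_le_one₀ (by norm_num) (by norm_num))
      nlinarith
    have hs : √(T * ((1 / 128) ^ n) ^ 2) = √T * (1 / 128) ^ n := by
      rw [Real.sqrt_mul hT.le, Real.sqrt_sq (by positivity)]
    have key := abs_primitive_le (T := T) (g := g) (H := fun s => G n s - G (n + 1) s)
      (D := fun t => N n t - N (n + 1) t) (A := C * (1 / 256) ^ n) (B := 65 * C * 64 ^ n)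
      (d := c n - c (n + 1)) (by positivity) (by positivity) hg ((hG n).sub (hG (n + 1))) ?_ ?_ ?_
      hτ hτT ht
    · rw [Real.dist_eq]
      refine key.trans (le_of_eq ?_)
      rw [hs]
      have e1 : (1 / 256 : ℝ) ^ n = (1 / 128) ^ n * (1 / 2) ^ n := by rw [← mul_pow]; norm_num
      have e2 : (64 : ℝ) ^ n * (1 / 128) ^ n = (1 / 2) ^ n := by rw [← mul_pow]; norm_num
      have e3 : (1 / 2 : ℝ) ^ n = 1 / 2 ^ n := by rw [one_div_pow]
      have hp : (0 : ℝ) < (1 / 128) ^ n := by positivity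
      have hT' : 0 < √T := Real.sqrt_pos.2 hT
      have e4 : C * (1 / 256) ^ n / (√T * (1 / 128) ^ n) = C / √T * (1 / 2 ^ n) := by
        rw [e1, ← e3]; field_simp
      have e5 : 65 * C * 64 ^ n * (√T * (1 / 128) ^ n) = 65 * C * √T * (1 / 2 ^ n) := by
        rw [← e3, ← e2]; ring
      rw [e4, e5]
      ring
    · filter_upwards [hGg n, hGg (n + 1)] with t h1 h2
      calc |G n t - G (n + 1) t| ≤ |G n t| + |G (n + 1) t| := abs_sub _ _
        _ ≤ C * 64 ^ n * |g t| + C * 64 ^ (n + 1) * |g t| := add_le_add h1 h2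
        _ = 65 * C * 64 ^ n * |g t| := by ring
    · intro t ht
      have h : ∀ m, IntegrableOn (G m) (Ioc 0 t) := fun m =>
        (hG m).mono_set (Ioc_subset_Ioc_right ht.2)
      simp only [hN]
      rw [integral_sub (h n) (h (n + 1))]
      ring
    · filter_upwards [hM n, hM (n + 1), hMg n] with t h1 h2 h3
      simpa only [hN, ← h1, ← h2] using h3
  have hK0 : 0 ≤ K := by
    have := dist_nonneg.trans (hK 0 0 ⟨le_rfl, hT.le⟩)
    simp only [pow_zero, div_one] at this
    linarith
  have hN0 : ∀ n, N n 0 = c n := fun n => by simp [hN]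
  -- The uniform estimate includes `t = 0`, which controls the initial values by the same rate as
  -- the functions.
  have hcL : ∀ n, dist (c n) L ≤ K / 2 ^ n := fun n =>
    dist_le_of_le_geometric_two_of_tendsto (f := c)
      (fun m => by simpa only [hN0] using hK m 0 ⟨le_rfl, hT.le⟩) hc n
  have hFN : ∀ᵐ t ∂volume.restrict (Ioc 0 T), ∀ n, dist (N n t) (F t) ≤ K / 2 ^ n := by
    filter_upwards [ae_all_iff.2 hM, hMF, ae_restrict_mem measurableSet_Ioc] with t h1 h2 ht n
    refine dist_le_of_le_geometric_two_of_tendsto (f := fun n => N n t)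
      (fun m => hK m t ⟨ht.1.le, ht.2⟩) ?_ n
    simpa only [h1] using h2
  rw [EssLimAtZero, Metric.tendsto_nhds]
  intro ε hε
  obtain ⟨n, hn⟩ : ∃ n : ℕ, K / 2 ^ n < ε / 3 := by
    have : Tendsto (fun n : ℕ => K / (2 : ℝ) ^ n) atTop (𝓝 0) :=
      tendsto_const_nhds.div_atTop (tendsto_pow_atTop_atTop_of_one_lt (by norm_num))
    exact (this.eventually_lt_const (by positivity)).exists
  have hcont : Tendsto (N n) (𝓝[>] 0) (𝓝 (c n)) := by
    have h := intervalIntegral.continuousOn_primitive (μ := volume) (f := G n) (a := 0) (b := T)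
      ((hG n).congr_set_ae Ioc_ae_eq_Icc.symm)
    have h0 : Tendsto (fun x => ∫ t in Ioc 0 x, G n t) (𝓝[Icc 0 T] 0) (𝓝 0) := by
      have h' := h 0 ⟨le_rfl, hT.le⟩
      rw [ContinuousWithinAt] at h'
      simpa using h'
    have h1 : 𝓝[>] (0 : ℝ) ≤ 𝓝[Icc 0 T] 0 := by
      rw [← nhdsWithin_Ioc_eq_nhdsGT hT]
      exact nhdsWithin_mono _ Ioc_subset_Icc_self
    simpa [hN] using (h0.mono_left h1).const_sub (c n)
  have hA : ∀ᶠ t in 𝓝[>] (0 : ℝ), dist (N n t) (c n) < ε / 3 :=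
    Metric.tendsto_nhds.1 hcont _ (by positivity)
  have hI : ∀ᶠ t in 𝓝[>] (0 : ℝ), t ∈ Ioc 0 T := Ioc_mem_nhdsGT hT
  rw [ae_restrict_iff' measurableSet_Ioc] at hFN
  filter_upwards [(hA.and hI).filter_mono inf_le_left, hFN.filter_mono inf_le_right]
    with t ht h2
  have h3 := h2 ht.2 n
  calc dist (F t) L ≤ dist (F t) (N n t) + dist (N n t) (c n) + dist (c n) L :=
        dist_triangle4 _ _ _ _
    _ < ε := by rw [dist_comm]; linarith [hcL n, ht.1]

end

/-! ### Smooth kernels supported in a cone -/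

section

open scoped ContDiff

/-- The directional derivative of `ψ` along `v`. -/
noncomputable def dirD (v : Plane) (ψ : Plane → ℝ) (x : Plane) : ℝ := fderiv ℝ ψ x v

/-- The mass preserving dilation of a kernel. -/
noncomputable def scale (ε : ℝ) (K : Plane → ℝ) (z : Plane) : ℝ := (ε ^ 2)⁻¹ * K (ε⁻¹ • z)

/-- The open cone spanned by the basis vectors `e⁻¹(1,0)` and `e⁻¹(0,1)`. -/
def openCone (e : Plane ≃L[ℝ] ℝ × ℝ) : Set Plane := {z | 0 < (e z).1 ∧ 0 < (e z).2}

/-- A smooth kernel `κ` with `∫ κ = 1` whose dilation difference is a second derivative. -/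
lemma exists_kernel_real : ∃ κ m : ℝ → ℝ, ContDiff ℝ ∞ κ ∧ ContDiff ℝ ∞ m ∧
    tsupport κ ⊆ Icc 1 2 ∧ tsupport m ⊆ Icc (1 / 16) 2 ∧ ∫ s, κ s = 1 ∧
    ∀ s, deriv (deriv m) s = κ s - 16 * κ (16 * s) := by
  -- A smoothed positive part: `0` up to `1`, the identity from `2` on. Hence `p''` lives on `[1,2]`
  -- and has integral `1 - 0`.
  set p : ℝ → ℝ := fun s => s * Real.smoothTransition (s - 1) with hp
  have hpc : ContDiff ℝ ∞ p :=
    contDiff_id.mul (Real.smoothTransition.contDiff.comp (contDiff_id.sub contDiff_const))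
  have hp0 : ∀ s ≤ 1, p s = 0 := fun s hs => by
    simp [hp, Real.smoothTransition.zero_of_nonpos (sub_nonpos.2 hs)]
  have hp1 : ∀ s, 2 ≤ s → p s = s := fun s hs => by
    simp [hp, Real.smoothTransition.one_of_one_le (by linarith : 1 ≤ s - 1)]
  have hd0 : ∀ s < 1, deriv p s = 0 := fun s hs => by
    have : p =ᶠ[𝓝 s] fun _ => 0 := by
      filter_upwards [Iio_mem_nhds hs] with y hy using hp0 y hy.le
    rw [this.deriv_eq, deriv_const]
  have hd1 : ∀ s, 2 < s → deriv p s = 1 := fun s hs => by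
    have : p =ᶠ[𝓝 s] id := by
      filter_upwards [Ioi_mem_nhds hs] with y hy using hp1 y hy.le
    rw [this.deriv_eq, deriv_id]
  have hdd0 : ∀ s < 1, deriv (deriv p) s = 0 := fun s hs => by
    have : deriv p =ᶠ[𝓝 s] fun _ => 0 := by
      filter_upwards [Iio_mem_nhds hs] with y hy using hd0 y hy
    rw [this.deriv_eq, deriv_const]
  have hdd1 : ∀ s, 2 < s → deriv (deriv p) s = 0 := fun s hs => by
    have : deriv p =ᶠ[𝓝 s] fun _ => 1 := by
      filter_upwards [Ioi_mem_nhds hs] with y hy using hd1 y hy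
    rw [this.deriv_eq, deriv_const]
  have hdc : ContDiff ℝ ∞ (deriv p) := (contDiff_infty_iff_deriv.1 hpc).2
  have hddc : ContDiff ℝ ∞ (deriv (deriv p)) := (contDiff_infty_iff_deriv.1 hdc).2
  have hpd : Differentiable ℝ p := hpc.differentiable (by simp)
  have hpdd : Differentiable ℝ (deriv p) := hdc.differentiable (by simp)
  have hsupp : Function.support (deriv (deriv p)) ⊆ Icc 1 2 := fun s hs => by
    by_contra h
    rw [mem_Icc, not_and_or, not_le, not_le] at h
    rcases h with h | h
    · exact hs (hdd0 s h)
    · exact hs (hdd1 s h)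
  -- The two terms of `m` both equal `s` for `s ≥ 2`, so they cancel there; this makes `m` compactly
  -- supported.
  refine ⟨deriv (deriv p), fun s => p s - 1 / 16 * p (16 * s), hddc,
    hpc.sub (contDiff_const.mul (hpc.comp (contDiff_const.mul contDiff_id))),
    closure_minimal hsupp isClosed_Icc, closure_minimal ?_ isClosed_Icc, ?_, ?_⟩
  · intro s hs
    by_contra h
    rw [mem_Icc, not_and_or, not_le, not_le] at h
    rcases h with h | h
    · exact hs (by simp only [hp0 s (by linarith), hp0 (16 * s) (by linarith)]; ring)
    · exact hs (by simp only [hp1 s (by linarith), hp1 (16 * s) (by linarith)]; ring)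
  · have h1 : ∫ s in (0 : ℝ)..3, deriv (deriv p) s = deriv p 3 - deriv p 0 :=
      intervalIntegral.integral_deriv_eq_sub (fun s _ => hpdd s)
        (hddc.continuous.intervalIntegrable _ _)
    rw [hd1 3 (by norm_num), hd0 0 (by norm_num), intervalIntegral.integral_of_le (by norm_num),
      setIntegral_eq_integral_of_forall_compl_eq_zero] at h1
    · simpa using h1
    · intro s hs
      by_contra h
      exact hs ⟨by linarith [(hsupp h).1], by linarith [(hsupp h).2]⟩
  · intro s
    have e1 : deriv (fun s => p s - 1 / 16 * p (16 * s))
        = fun s => deriv p s - deriv p (16 * s) := by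
      ext s
      have h : HasDerivAt (fun s => p (16 * s)) (deriv p (16 * s) * 16) s :=
        HasDerivAt.comp s (hpd (16 * s)).hasDerivAt (by simpa using (hasDerivAt_id s).const_mul 16)
      refine ((hpd s).hasDerivAt.fun_sub (h.const_mul (1 / 16))).deriv.trans ?_
      ring
    have h : HasDerivAt (fun s => deriv p (16 * s)) (deriv (deriv p) (16 * s) * 16) s :=
      HasDerivAt.comp s (hpdd (16 * s)).hasDerivAt
        (by simpa using (hasDerivAt_id s).const_mul 16)
    rw [e1, ((hpdd s).hasDerivAt.fun_sub h).deriv]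
    ring

section Tensor

variable (e : Plane ≃L[ℝ] ℝ × ℝ) {g h : ℝ → ℝ}

/-- The product kernel `g ⊗ h` in the coordinates `e`. -/
def tensor (g h : ℝ → ℝ) (z : Plane) : ℝ := g (e z).1 * h (e z).2

lemma isTestFunction_tensor (hg : ContDiff ℝ ∞ g) (hh : ContDiff ℝ ∞ h) {δ : ℝ} (hδ : 0 < δ)
    (hgs : tsupport g ⊆ Icc δ 2) (hhs : tsupport h ⊆ Icc δ 2) :
    IsTestFunction (openCone e) (tensor e g h) := by
  have hs : tsupport (tensor e g h) ⊆ e ⁻¹' (Icc δ 2 ×ˢ Icc δ 2) := by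
    refine closure_minimal (fun z hz => ?_) ((isClosed_Icc.prod isClosed_Icc).preimage e.continuous)
    have hz' : g (e z).1 * h (e z).2 ≠ 0 := hz
    exact ⟨hgs (subset_tsupport _ (left_ne_zero_of_mul hz')),
      hhs (subset_tsupport _ (right_ne_zero_of_mul hz'))⟩
  refine ⟨?_, ?_, hs.trans fun z hz => ⟨hδ.trans_le hz.1.1, hδ.trans_le hz.2.1⟩⟩
  · exact (hg.comp (contDiff_fst.comp e.contDiff)).mul (hh.comp (contDiff_snd.comp e.contDiff))
  · have : IsCompact (e ⁻¹' (Icc δ 2 ×ˢ Icc δ 2)) :=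
      e.toHomeomorph.isCompact_preimage.2 (isCompact_Icc.prod isCompact_Icc)
    exact this.of_isClosed_subset (isClosed_tsupport _) hs

lemma dirD_tensor (hg : Differentiable ℝ g) (hh : Differentiable ℝ h) (z : Plane) :
    dirD (e.symm (1, 0)) (tensor e g h) z = tensor e (deriv g) h z ∧
      dirD (e.symm (0, 1)) (tensor e g h) z = tensor e g (deriv h) z := by
  have h1 : HasFDerivAt (fun z => (e z).1)
      ((ContinuousLinearMap.fst ℝ ℝ ℝ).comp (e : Plane →L[ℝ] ℝ × ℝ)) z :=
    ((ContinuousLinearMap.fst ℝ ℝ ℝ).comp (e : Plane →L[ℝ] ℝ × ℝ)).hasFDerivAt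
  have h2 : HasFDerivAt (fun z => (e z).2)
      ((ContinuousLinearMap.snd ℝ ℝ ℝ).comp (e : Plane →L[ℝ] ℝ × ℝ)) z :=
    ((ContinuousLinearMap.snd ℝ ℝ ℝ).comp (e : Plane →L[ℝ] ℝ × ℝ)).hasFDerivAt
  have hG := (hg (e z).1).hasDerivAt.comp_hasFDerivAt z h1
  have hH := (hh (e z).2).hasDerivAt.comp_hasFDerivAt z h2
  have := (hG.mul hH).fderiv
  have e1 : fderiv ℝ (tensor e g h) z = _ := this
  simp only [dirD, e1, tensor]
  constructor <;> simp [mul_comm]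

/-- The coordinates `e` change volume by a constant, the ratio of two Haar measures. Its value is
irrelevant because the kernel is normalised by it. -/
lemma integral_tensor : ∃ c : ℝ, 0 < c ∧ ∀ g h : ℝ → ℝ,
    ∫ z, tensor e g h z = c * ((∫ s, g s) * ∫ s, h s) := by
  set μ' : Measure (ℝ × ℝ) := (volume : Measure Plane).map e
  have : μ'.IsAddHaarMeasure := e.isAddHaarMeasure_map volume
  refine ⟨μ'.addHaarScalarFactor volume, ?_, fun g h => ?_⟩
  · exact_mod_cast Measure.addHaarScalarFactor_pos_of_isAddHaarMeasure μ' volume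
  · have h1 : ∫ z, tensor e g h z = ∫ y, g y.1 * h y.2 ∂μ' :=
      (e.toHomeomorph.measurableEmbedding.integral_map (fun y : ℝ × ℝ => g y.1 * h y.2)).symm
    have h2 := Measure.isAddLeftInvariant_eq_smul μ' volume
    generalize μ'.addHaarScalarFactor volume = c at h2 ⊢
    rw [h1, h2, integral_smul_nnreal_measure, Measure.volume_eq_prod, integral_prod_mul]
    rfl

end Tensor

lemma IsTestFunction.const_mul {U : Set Plane} {K : Plane → ℝ} (hK : IsTestFunction U K) (c : ℝ) :
    IsTestFunction U (fun z => c * K z) := by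
  have : tsupport (fun z => c * K z) ⊆ tsupport K :=
    closure_mono fun z hz => right_ne_zero_of_mul hz
  exact ⟨contDiff_const.mul hK.1, hK.2.1.mono' (subset_closure.trans this), this.trans hK.2.2⟩

lemma dirD_const_mul (v : Plane) {K : Plane → ℝ} (hK : Differentiable ℝ K) (c : ℝ) :
    dirD v (fun z => c * K z) = fun z => c * dirD v K z := by
  ext z
  simp [dirD, fderiv_const_mul (hK z)]

lemma IsTestFunction.differentiable {U : Set Plane} {K : Plane → ℝ} (hK : IsTestFunction U K) :
    Differentiable ℝ K := hK.1.differentiable (by simp)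

lemma IsTestFunction.dirD {U : Set Plane} {K : Plane → ℝ} (hK : IsTestFunction U K) (v : Plane) :
    IsTestFunction U (dirD v K) := by
  refine ⟨?_, hK.2.1.fderiv_apply (𝕜 := ℝ) v, (tsupport_fderiv_apply_subset ℝ v).trans hK.2.2⟩
  exact (hK.1.fderiv_right (m := ∞) (by simp)).clm_apply contDiff_const

/-- A kernel supported in a cone, of mass one, whose dilation differences are sums of second
derivatives of kernels in the same cone. -/
lemma exists_kernel (e : Plane ≃L[ℝ] ℝ × ℝ) : ∃ k Q₁ Q₂ : Plane → ℝ,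
    IsTestFunction (openCone e) k ∧ IsTestFunction (openCone e) Q₁ ∧
    IsTestFunction (openCone e) Q₂ ∧ ∫ z, k z = 1 ∧
    ∀ z, k z - scale (1 / 16) k z = dirD (e.symm (1, 0)) (dirD (e.symm (1, 0)) Q₁) z +
      dirD (e.symm (0, 1)) (dirD (e.symm (0, 1)) Q₂) z := by
  obtain ⟨κ, m, hκ, hm, hκs, hms, hκi, hκm⟩ := exists_kernel_real
  obtain ⟨c, hc, hi⟩ := integral_tensor e
  set κ' : ℝ → ℝ := fun s => 16 * κ (16 * s) with hκ'
  have hκ'c : ContDiff ℝ ∞ κ' := contDiff_const.mul (hκ.comp (contDiff_const.mul contDiff_id))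
  have hκ's : tsupport κ' ⊆ Icc (1 / 16) 2 := by
    refine closure_minimal (fun s hs => ?_) isClosed_Icc
    have := hκs (subset_tsupport _ (right_ne_zero_of_mul hs))
    exact ⟨by linarith [this.1], by linarith [this.2]⟩
  have hκs' : tsupport κ ⊆ Icc (1 / 16) 2 := hκs.trans (Icc_subset_Icc_left (by norm_num))
  have hδ : (0 : ℝ) < 1 / 16 := by norm_num
  have hm' : ContDiff ℝ ∞ (deriv m) := (contDiff_infty_iff_deriv.1 hm).2
  have hd : ∀ {q : ℝ → ℝ}, ContDiff ℝ ∞ q → Differentiable ℝ q := fun h =>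
    h.differentiable (by simp)
  have t1 := isTestFunction_tensor e hm hκ hδ hms hκs'
  have t2 := isTestFunction_tensor e hκ'c hm hδ hκ's hms
  -- Telescoping one factor at a time: `κ⊗κ - κ'⊗κ' = (κ - κ')⊗κ + κ'⊗(κ - κ')`, where `κ - κ' =
  -- m''`.
  refine ⟨fun z => c⁻¹ * tensor e κ κ z, fun z => c⁻¹ * tensor e m κ z,
    fun z => c⁻¹ * tensor e κ' m z, (isTestFunction_tensor e hκ hκ hδ hκs' hκs').const_mul _,
    t1.const_mul _, t2.const_mul _, ?_, fun z => ?_⟩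
  · rw [integral_const_mul, hi, hκi, mul_one, mul_one, inv_mul_cancel₀ hc.ne']
  · have a1 : dirD (e.symm (1, 0)) (tensor e m κ) = tensor e (deriv m) κ :=
      funext fun z => (dirD_tensor e (hd hm) (hd hκ) z).1
    have b1 : dirD (e.symm (0, 1)) (tensor e κ' m) = tensor e κ' (deriv m) :=
      funext fun z => (dirD_tensor e (hd hκ'c) (hd hm) z).2
    rw [dirD_const_mul _ t1.differentiable, dirD_const_mul _ t2.differentiable,
      dirD_const_mul _ (t1.dirD _).differentiable, dirD_const_mul _ (t2.dirD _).differentiable,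
      a1, b1]
    beta_reduce
    rw [(dirD_tensor e (hd hm') (hd hκ) z).1,
      (dirD_tensor e (hd hκ'c) (hd hm') z).2]
    simp only [scale, tensor, hκm, hκ', map_smul, Prod.smul_fst, Prod.smul_snd, smul_eq_mul]
    norm_num
    ring

end

/-! ### Translations, convolution and dilation in `L²` -/

section

open scoped ContDiff Convolution Pointwise

lemma norm_sq_Lp_two {α : Type*} [MeasurableSpace α] {m : Measure α} (f : Lp ℝ 2 m) :
    ‖f‖ ^ 2 = ∫ x, f x ^ 2 ∂m := by
  rw [← real_inner_self_eq_norm_sq, L2.inner_def]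
  exact integral_congr_ae (ae_of_all _ fun x => by simp [pow_two])

lemma norm_sq_toLp {α : Type*} [MeasurableSpace α] {m : Measure α} {f : α → ℝ}
    (hf : MemLp f 2 m) : ‖hf.toLp f‖ ^ 2 = ∫ x, f x ^ 2 ∂m := by
  rw [norm_sq_Lp_two]
  exact integral_congr_ae (by filter_upwards [hf.coeFn_toLp] with x hx; rw [hx])

lemma abs_integral_mul_le_sqrt {α : Type*} [MeasurableSpace α] {m : Measure α} {f g : α → ℝ}
    (hf : MemLp f 2 m) (hg : MemLp g 2 m) :
    |∫ x, f x * g x ∂m| ≤ √(∫ x, f x ^ 2 ∂m) * √(∫ x, g x ^ 2 ∂m) := by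
  have h := abs_real_inner_le_norm (hf.toLp f) (hg.toLp g)
  rw [← Real.sqrt_sq (norm_nonneg (hf.toLp f)), ← Real.sqrt_sq (norm_nonneg (hg.toLp g)),
    norm_sq_toLp, norm_sq_toLp, L2.inner_def] at h
  refine le_trans (le_of_eq ?_) h
  congr 1
  refine integral_congr_ae ?_
  filter_upwards [hf.coeFn_toLp, hg.coeFn_toLp] with x h1 h2
  rw [h1, h2]
  simp [mul_comm]

/-- The squared `L²` distance between `f` and its translate by `z`. -/
noncomputable def shiftSq (f : Plane → ℝ) (z : Plane) : ℝ := ∫ x, (f (x - z) - f x) ^ 2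

/-- The convolution `f * K`. -/
noncomputable def conv (f K : Plane → ℝ) : Plane → ℝ :=
  f ⋆[ContinuousLinearMap.lsmul ℝ ℝ, volume] K

lemma conv_apply (f K : Plane → ℝ) (x : Plane) : conv f K x = ∫ z, f (x - z) * K z := by
  simp [conv, convolution_lsmul_swap]

lemma memLp_comp_sub {f : Plane → ℝ} (hf : MemLp f 2) (z : Plane) :
    MemLp (fun x => f (x - z)) 2 :=
  hf.comp_measurePreserving (measurePreserving_sub_right volume z)

lemma memLp_shift {f : Plane → ℝ} (hf : MemLp f 2) (z : Plane) :
    MemLp (fun x => f (x - z) - f x) 2 := (memLp_comp_sub hf z).sub hf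

/-- Translation acts continuously on `L²`, as composition with a continuous family of measure
preserving maps. -/
lemma tendsto_shiftSq {f : Plane → ℝ} (hf : MemLp f 2) : Tendsto (shiftSq f) (𝓝 0) (𝓝 0) := by
  set c : Plane → C(Plane, Plane) := fun z => ⟨fun x => x - z, by fun_prop⟩ with hc
  have hcm : ∀ z, MeasurePreserving (c z) volume volume := fun z =>
    measurePreserving_sub_right volume z
  have hcc : Continuous c := by
    let q : C(Plane × Plane, Plane) := ⟨fun p => p.2 - p.1, by fun_prop⟩
    exact q.curry.continuous
  have hcont := (continuous_const (y := hf.toLp f)).compMeasurePreservingLp hcc hcm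
    (by norm_num : (2 : ℝ≥0∞) ≠ ⊤)
  have key : ∀ z, shiftSq f z
      = ‖Lp.compMeasurePreserving (c z) (hcm z) (hf.toLp f) - hf.toLp f‖ ^ 2 := by
    intro z
    rw [Lp.toLp_compMeasurePreserving hf (hcm z), ← MemLp.toLp_sub, norm_sq_toLp]
    rfl
  have h0 : Lp.compMeasurePreserving (c 0) (hcm 0) (hf.toLp f) = hf.toLp f := by
    rw [Lp.toLp_compMeasurePreserving hf (hcm 0)]
    congr 1
    ext x
    simp [hc]
  have h := ((hcont.sub (continuous_const (y := hf.toLp f))).norm.pow 2).tendsto 0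
  have h1 : shiftSq f 0 = 0 := by simp [shiftSq]
  rw [← h1]
  refine (h.congr fun z => (key z).symm).trans_eq ?_
  exact congrArg 𝓝 (key 0).symm

/-- Minkowski's inequality for averages of `τ_z f - f`. -/
lemma memLp_average {f K : Plane → ℝ} (hf : MemLp f 2) (hK : Continuous K)
    (hKs : HasCompactSupport K) {D : ℝ} (hD0 : 0 ≤ D)
    (hD : ∀ z ∈ Function.support K, shiftSq f z ≤ D) :
    MemLp (fun x => ∫ z, (f (x - z) - f x) * K z) 2 ∧
      ∫ x, (∫ z, (f (x - z) - f x) * K z) ^ 2 ≤ D * (∫ z, |K z|) ^ 2 := by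
  -- With the finite measure `|K| dz`, the claim is Cauchy–Schwarz in `z` followed by Tonelli.
  set ν : Measure Plane := volume.withDensity fun z => ‖K z‖ₑ with hν
  have hKi : Integrable K := hK.integrable_of_hasCompactSupport hKs
  have hνu : ν univ = ENNReal.ofReal (∫ z, |K z|) := by
    rw [hν, withDensity_apply _ MeasurableSet.univ, Measure.restrict_univ,
      ← ofReal_integral_norm_eq_lintegral_enorm hKi]
    rfl
  have : IsFiniteMeasure ν := ⟨by rw [hνu]; exact ENNReal.ofReal_lt_top⟩
  have hm : AEStronglyMeasurable (fun p : Plane × Plane => f (p.1 - p.2) - f p.1)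
      (volume.prod volume) :=
    (hf.1.comp_quasiMeasurePreserving
      (quasiMeasurePreserving_sub_of_right_invariant volume volume)).sub hf.1.comp_fst
  have hmν : AEStronglyMeasurable (fun p : Plane × Plane => f (p.1 - p.2) - f p.1)
      (volume.prod ν) :=
    hm.mono_ac (Measure.AbsolutelyContinuous.rfl.prod (withDensity_absolutelyContinuous _ _))
  have hmK : AEStronglyMeasurable (fun p : Plane × Plane => (f (p.1 - p.2) - f p.1) * K p.2)
      (volume.prod volume) := hm.mul (hK.comp continuous_snd).aestronglyMeasurable
  have hmeas : AEStronglyMeasurable (fun x => ∫ z, (f (x - z) - f x) * K z) volume :=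
    hmK.integral_prod_right'
  have hpt : ∀ x, ‖∫ z, (f (x - z) - f x) * K z‖ₑ ≤ ∫⁻ z, ‖f (x - z) - f x‖ₑ ∂ν := by
    intro x
    refine (enorm_integral_le_lintegral_enorm _).trans (le_of_eq ?_)
    rw [hν, lintegral_withDensity_eq_lintegral_mul_non_measurable₀ _
      hK.enorm.measurable.aemeasurable (ae_of_all _ fun _ => enorm_lt_top)]
    exact lintegral_congr fun z => by rw [enorm_mul, mul_comm]; rfl
  have hcs : ∀ᵐ x, (∫⁻ z, ‖f (x - z) - f x‖ₑ ∂ν) ^ 2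
      ≤ ν univ * ∫⁻ z, ‖f (x - z) - f x‖ₑ ^ 2 ∂ν := by
    filter_upwards [hmν.prodMk_left] with x hx
    have h := ENNReal.lintegral_mul_le_Lp_mul_Lq ν Real.HolderConjugate.two_two
      (f := fun z => ‖f (x - z) - f x‖ₑ) (g := fun _ => 1) hx.enorm aemeasurable_const
    simp only [Pi.mul_apply, mul_one, ENNReal.rpow_two, one_pow, lintegral_one] at h
    calc _ ≤ ((∫⁻ z, ‖f (x - z) - f x‖ₑ ^ 2 ∂ν) ^ (1 / 2 : ℝ) * ν univ ^ (1 / 2 : ℝ)) ^ 2 := by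
          gcongr
      _ = _ := by
          rw [mul_pow, ← ENNReal.rpow_natCast, ← ENNReal.rpow_natCast, ← ENNReal.rpow_mul,
            ← ENNReal.rpow_mul]
          norm_num
          rw [mul_comm]
  have hshift : ∀ z, ∫⁻ x, ‖f (x - z) - f x‖ₑ ^ 2 = ENNReal.ofReal (shiftSq f z) := by
    intro z
    rw [shiftSq, ofReal_integral_eq_lintegral_ofReal (memLp_shift hf z).integrable_sq
      (ae_of_all _ fun _ => sq_nonneg _)]
    refine lintegral_congr fun x => ?_
    rw [Real.enorm_eq_ofReal_abs, ← ENNReal.ofReal_pow (abs_nonneg _), sq_abs]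
  have hνae : ∀ᵐ z ∂ν, z ∈ Function.support K := by
    rw [hν, ae_withDensity_iff hK.enorm.measurable]
    exact ae_of_all _ fun z hz => by simpa using hz
  have hlin : ∫⁻ x, ‖∫ z, (f (x - z) - f x) * K z‖ₑ ^ 2
      ≤ ENNReal.ofReal (D * (∫ z, |K z|) ^ 2) := by
    calc _ ≤ ∫⁻ x, ν univ * ∫⁻ z, ‖f (x - z) - f x‖ₑ ^ 2 ∂ν := by
          refine lintegral_mono_ae ?_
          filter_upwards [hcs] with x hx
          exact (pow_le_pow_left' (hpt x) 2).trans hx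
      _ = ν univ * ∫⁻ z, (∫⁻ x, ‖f (x - z) - f x‖ₑ ^ 2) ∂ν := by
          rw [lintegral_const_mul' _ _ (measure_ne_top _ _),
            lintegral_lintegral_swap (hmν.enorm.pow_const 2)]
      _ ≤ ν univ * ∫⁻ z, ENNReal.ofReal D ∂ν := by
          refine mul_le_mul_right (lintegral_mono_ae ?_) _
          filter_upwards [hνae] with z hz
          rw [hshift]
          exact ENNReal.ofReal_le_ofReal (hD z hz)
      _ = _ := by
          rw [lintegral_const, hνu, ENNReal.ofReal_mul hD0, ENNReal.ofReal_pow (by positivity)]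
          ring
  have hmem : MemLp (fun x => ∫ z, (f (x - z) - f x) * K z) 2 := by
    refine ⟨hmeas, ?_⟩
    rw [eLpNorm_lt_top_iff_lintegral_rpow_enorm_lt_top (by norm_num) (by norm_num)]
    simpa using hlin.trans_lt ENNReal.ofReal_lt_top
  refine ⟨hmem, ?_⟩
  rw [← ENNReal.ofReal_le_ofReal_iff (by positivity),
    ofReal_integral_eq_lintegral_ofReal hmem.integrable_sq (ae_of_all _ fun _ => sq_nonneg _)]
  refine le_trans (le_of_eq (lintegral_congr fun x => ?_)) hlin
  rw [Real.enorm_eq_ofReal_abs, ← ENNReal.ofReal_pow (abs_nonneg _), sq_abs]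

section Conv

variable {f K : Plane → ℝ}

lemma integrable_conv_integrand (hf : LocallyIntegrable f) (hK : Continuous K)
    (hKs : HasCompactSupport K) (x : Plane) : Integrable fun z => f (x - z) * K z := by
  have h := (hKs.convolutionExists_right (ContinuousLinearMap.lsmul ℝ ℝ) hf hK x).integrable_swap
  simpa using h

lemma integral_shift_mul (hf : LocallyIntegrable f) (hK : Continuous K)
    (hKs : HasCompactSupport K) (x : Plane) :
    ∫ z, (f (x - z) - f x) * K z = conv f K x - f x * ∫ z, K z := by
  rw [conv_apply, ← integral_const_mul, ← integral_sub (integrable_conv_integrand hf hK hKs x)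
    ((hK.integrable_of_hasCompactSupport hKs).const_mul _)]
  exact integral_congr_ae (ae_of_all _ fun z => by ring)

/-- Convolution with a kernel of mean zero. -/
lemma integral_conv_sq_le_of_integral_eq_zero (hf : MemLp f 2) (hK : Continuous K)
    (hKs : HasCompactSupport K) (hK0 : ∫ z, K z = 0) {D : ℝ} (hD0 : 0 ≤ D)
    (hD : ∀ z ∈ Function.support K, shiftSq f z ≤ D) :
    ∫ x, conv f K x ^ 2 ≤ D * (∫ z, |K z|) ^ 2 := by
  have h := (memLp_average hf hK hKs hD0 hD).2
  simpa only [integral_shift_mul (hf.locallyIntegrable (by norm_num)) hK hKs, hK0, mul_zero,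
    sub_zero] using h

/-- Convolution with a kernel of mass one. -/
lemma integral_conv_sub_sq_le (hf : MemLp f 2) (hK : Continuous K)
    (hKs : HasCompactSupport K) (hK1 : ∫ z, K z = 1) {D : ℝ} (hD0 : 0 ≤ D)
    (hD : ∀ z ∈ Function.support K, shiftSq f z ≤ D) :
    MemLp (fun x => conv f K x - f x) 2 ∧
      ∫ x, (conv f K x - f x) ^ 2 ≤ D * (∫ z, |K z|) ^ 2 := by
  have h := memLp_average hf hK hKs hD0 hD
  simpa only [integral_shift_mul (hf.locallyIntegrable (by norm_num)) hK hKs, hK1, mul_one]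
    using h

lemma dirD_conv (hf : LocallyIntegrable f) (hK : ContDiff ℝ ∞ K) (hKs : HasCompactSupport K)
    (v : Plane) : dirD v (conv f K) = conv f (dirD v K) := by
  ext x
  have h := hKs.hasFDerivAt_convolution_right (ContinuousLinearMap.lsmul ℝ ℝ) hf
    (hK.of_le (by simp)) x
  rw [dirD, conv, h.fderiv, convolution_precompR_apply _ hf (hKs.fderiv ℝ)
    (hK.continuous_fderiv (by simp))]
  rfl

lemma isTestFunction_conv {Ω S : Set Plane} (hf : LocallyIntegrable f) (hS : IsCompact S)
    (hfS : Function.support f ⊆ S) (hK : ContDiff ℝ ∞ K) (hKs : HasCompactSupport K)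
    (hΩ : S + tsupport K ⊆ Ω) : IsTestFunction Ω (conv f K) := by
  have hc : IsCompact (S + tsupport K) := hS.add hKs.isCompact
  have hsub : tsupport (conv f K) ⊆ S + tsupport K :=
    closure_minimal ((support_convolution_subset _).trans
      (add_subset_add hfS (subset_tsupport K))) hc.isClosed
  exact ⟨hKs.contDiff_convolution_right _ hf hK,
    hc.of_isClosed_subset (isClosed_tsupport _) hsub, hsub.trans hΩ⟩

end Conv

section Scale

variable {ε : ℝ} {K : Plane → ℝ}

lemma finrank_plane : Module.finrank ℝ Plane = 2 := by simp

lemma integral_scale (hε : 0 < ε) (K : Plane → ℝ) : ∫ z, scale ε K z = ∫ z, K z := by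
  simp only [scale]
  rw [integral_const_mul, Measure.integral_comp_smul, finrank_plane, smul_eq_mul, ← mul_assoc]
  rw [inv_pow, inv_inv, abs_of_pos (by positivity), inv_mul_cancel₀ (by positivity), one_mul]

lemma integral_abs_scale (hε : 0 < ε) (K : Plane → ℝ) :
    ∫ z, |scale ε K z| = ∫ z, |K z| := by
  rw [← integral_scale hε fun z => |K z|]
  refine integral_congr_ae (ae_of_all _ fun z => ?_)
  simp [scale, abs_mul, abs_inv]

lemma scale_scale (ε δ : ℝ) (K : Plane → ℝ) : scale ε (scale δ K) = scale (ε * δ) K := by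
  ext z
  simp only [scale, smul_smul, mul_pow, mul_inv]
  rw [mul_assoc, mul_comm δ⁻¹]

lemma dirD_scale (hK : Differentiable ℝ K) (v : Plane) :
    dirD v (scale ε K) = fun z => ε⁻¹ * scale ε (dirD v K) z := by
  ext z
  have h : HasFDerivAt (scale ε K)
      ((ε ^ 2)⁻¹ • ((fderiv ℝ K (ε⁻¹ • z)).comp (ε⁻¹ • ContinuousLinearMap.id ℝ Plane))) z :=
    ((hK _).hasFDerivAt.comp z ((hasFDerivAt_id z).const_smul ε⁻¹)).const_mul _
  rw [dirD, h.fderiv]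
  simp [scale, dirD]
  ring

lemma contDiff_scale (hK : ContDiff ℝ ∞ K) : ContDiff ℝ ∞ (scale ε K) :=
  contDiff_const.mul (hK.comp (contDiff_const_smul ε⁻¹))

lemma tsupport_scale_subset (hε : 0 < ε) : tsupport (scale ε K) ⊆ ε • tsupport K := by
  refine closure_minimal (fun z hz => ?_) ((isClosed_tsupport K).smul₀ ε)
  rw [mem_smul_set_iff_inv_smul_mem₀ hε.ne']
  exact subset_tsupport _ (right_ne_zero_of_mul hz)

lemma smul_mem_openCone {e : Plane ≃L[ℝ] ℝ × ℝ} {s : ℝ} (hs : 0 < s) {z : Plane}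
    (hz : z ∈ openCone e) : s • z ∈ openCone e := by
  simp only [openCone, mem_ofPred_eq, map_smul, Prod.smul_fst, Prod.smul_snd, smul_eq_mul] at hz ⊢
  exact ⟨mul_pos hs hz.1, mul_pos hs hz.2⟩

lemma add_mem_openCone {e : Plane ≃L[ℝ] ℝ × ℝ} {z w : Plane}
    (hz : z ∈ openCone e) (hw : w ∈ openCone e) : z + w ∈ openCone e := by
  simp only [openCone, mem_ofPred_eq, map_add, Prod.fst_add, Prod.snd_add] at hz hw ⊢
  exact ⟨add_pos hz.1 hw.1, add_pos hz.2 hw.2⟩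

lemma IsTestFunction.scale {e : Plane ≃L[ℝ] ℝ × ℝ} (hε : 0 < ε)
    (hK : IsTestFunction (openCone e) K) : IsTestFunction (openCone e) (scale ε K) := by
  refine ⟨contDiff_scale hK.1, ?_, (tsupport_scale_subset hε).trans ?_⟩
  · exact (hK.2.1.isCompact.smul ε).of_isClosed_subset (isClosed_tsupport _)
      (tsupport_scale_subset hε)
  · rintro _ ⟨z, hz, rfl⟩
    exact smul_mem_openCone hε (hK.2.2 hz)

end Scale

lemma integral_dirD_eq_zero {U : Set Plane} {K : Plane → ℝ} (hK : IsTestFunction U K)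
    (v : Plane) : ∫ z, dirD v K z = 0 := by
  have hi : Integrable (dirD v K) :=
    (hK.dirD v).1.continuous.integrable_of_hasCompactSupport (hK.dirD v).2.1
  have h := integral_mul_fderiv_eq_neg_fderiv_mul_of_integrable (μ := volume)
    (f := fun _ : Plane => (1 : ℝ)) (g := K) (v := v) (by simp) (by simpa using! hi)
    (by simpa using hK.1.continuous.integrable_of_hasCompactSupport hK.2.1)
    (fun x _ => differentiableAt_const _) (fun x _ => hK.differentiable x)
  simpa using! h

end

/-! ### Jets of test functions and duality with `H²(Ω)` -/

section

open scoped ContDiff Convolution Pointwise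

variable {Ω : Set Plane}

lemma IsTestFunction.memLp_volume {U : Set Plane} {ψ : Plane → ℝ} (hψ : IsTestFunction U ψ) :
    MemLp ψ 2 := hψ.1.continuous.memLp_of_hasCompactSupport hψ.2.1

lemma IsTestFunction.partialD {ψ : Plane → ℝ} (hψ : IsTestFunction Ω ψ) (i : Fin 2) :
    IsTestFunction Ω (partialD i ψ) := hψ.dirD _

lemma IsTestFunction.setIntegral_mul {ψ : Plane → ℝ} (hψ : IsTestFunction Ω ψ) (g : Plane → ℝ) :
    ∫ x in Ω, g x * ψ x = ∫ x, g x * ψ x :=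
  setIntegral_eq_integral_of_forall_compl_eq_zero fun x hx => by
    rw [image_eq_zero_of_notMem_tsupport fun h => hx (hψ.2.2 h), mul_zero]

lemma IsTestFunction.setIntegral_sq_le {ψ : Plane → ℝ} (hψ : IsTestFunction Ω ψ) :
    ∫ x in Ω, ψ x ^ 2 ≤ ∫ x, ψ x ^ 2 :=
  setIntegral_le_integral hψ.memLp_volume.integrable_sq (ae_of_all _ fun _ => sq_nonneg _)

lemma isWeakPartial_toLp {ψ : Plane → ℝ} (hψ : IsTestFunction Ω ψ) (i : Fin 2) :
    IsWeakPartial Ω i (hψ.memLp.toLp ψ) ((hψ.partialD i).memLp.toLp _) := by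
  intro η hη
  have e1 : ∫ x in Ω, hψ.memLp.toLp ψ x * ShockFilterCH.partialD i η x
      = ∫ x in Ω, ψ x * ShockFilterCH.partialD i η x :=
    integral_congr_ae (by filter_upwards [hψ.memLp.coeFn_toLp] with x hx; rw [hx])
  have e2 : ∫ x in Ω, (hψ.partialD i).memLp.toLp _ x * η x
      = ∫ x in Ω, ShockFilterCH.partialD i ψ x * η x :=
    integral_congr_ae (by filter_upwards [(hψ.partialD i).memLp.coeFn_toLp] with x hx; rw [hx])
  rw [e1, e2, (hη.partialD i).setIntegral_mul, hη.setIntegral_mul]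
  exact integral_mul_fderiv_eq_neg_fderiv_mul_of_integrable
    (by exact (hψ.partialD i).memLp_volume.integrable_mul hη.memLp_volume)
    (by exact hψ.memLp_volume.integrable_mul (hη.partialD i).memLp_volume)
    (hψ.memLp_volume.integrable_mul hη.memLp_volume)
    (fun x _ => hψ.differentiable x) (fun x _ => hη.differentiable x)

/-- The second order jet of a test function. -/
noncomputable def jet {ψ : Plane → ℝ} (hψ : IsTestFunction Ω ψ) : H2 Ω :=
  ⟨WithLp.toLp 2 fun
    | Sum.inl _ => hψ.memLp.toLp ψ
    | Sum.inr (Sum.inl i) => (hψ.partialD i).memLp.toLp _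
    | Sum.inr (Sum.inr (i, j)) => ((hψ.partialD i).partialD j).memLp.toLp _,
   fun i => isWeakPartial_toLp hψ i, fun i j => isWeakPartial_toLp (hψ.partialD i) j⟩

lemma fn_jet {ψ : Plane → ℝ} (hψ : IsTestFunction Ω ψ) :
    H2.fn (jet hψ) =ᵐ[volume.restrict Ω] ψ := hψ.memLp.coeFn_toLp

lemma norm_jet_le {ψ : Plane → ℝ} (hψ : IsTestFunction Ω ψ) {C : ℝ} (hC : 0 ≤ C)
    (h0 : ∫ x, ψ x ^ 2 ≤ C ^ 2) (h1 : ∀ i, ∫ x, partialD i ψ x ^ 2 ≤ C ^ 2)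
    (h2 : ∀ i j, ∫ x, partialD j (partialD i ψ) x ^ 2 ≤ C ^ 2) :
    ‖jet hψ‖ ≤ 3 * C := by
  have hn : ∀ {η : Plane → ℝ} (hη : IsTestFunction Ω η), ∫ x, η x ^ 2 ≤ C ^ 2 →
      ‖hη.memLp.toLp η‖ ^ 2 ≤ C ^ 2 := fun hη h => by
    rw [norm_sq_toLp]; exact hη.setIntegral_sq_le.trans h
  refine le_of_sq_le_sq ?_ (by positivity)
  have e : ‖jet hψ‖ ^ 2 = ‖(jet hψ).1‖ ^ 2 := rfl
  rw [e, PiLp.norm_sq_eq_of_L2, Fintype.sum_sum_type, Fintype.sum_sum_type, Fintype.sum_prod_type]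
  have a0 := hn hψ h0
  have a1 := fun i => hn (hψ.partialD i) (h1 i)
  have a2 := fun i j => hn ((hψ.partialD i).partialD j) (h2 i j)
  calc _ ≤ (∑ _ : Unit, C ^ 2) + ((∑ _ : Fin 2, C ^ 2) + ∑ _ : Fin 2, ∑ _ : Fin 2, C ^ 2) := by
        refine add_le_add (Finset.sum_le_sum fun _ _ => a0)
          (add_le_add (Finset.sum_le_sum fun i _ => a1 i)
            (Finset.sum_le_sum fun i _ => Finset.sum_le_sum fun j _ => a2 i j))
    -- A jet has `1 + 2 + 4 = 7` components, and `7 ≤ 9`.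
    _ ≤ (3 * C) ^ 2 := by simp; nlinarith [sq_nonneg C]

lemma H2.norm_fn_le (v : H2 Ω) : ‖H2.fn v‖ ≤ ‖v‖ := PiLp.norm_apply_le v.1 _

lemma H2.norm_grad_le (v : H2 Ω) (i : Fin 2) : ‖H2.grad v i‖ ≤ ‖v‖ := PiLp.norm_apply_le v.1 _

lemma H2.norm_hess_le (v : H2 Ω) (i j : Fin 2) : ‖H2.hess v i j‖ ≤ ‖v‖ :=
  PiLp.norm_apply_le v.1 _

lemma abs_setIntegral_mul_le (g : L2 Ω) {η : Plane → ℝ} (hη : MemLp η 2 (volume.restrict Ω)) :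
    |∫ x in Ω, g x * η x| ≤ ‖g‖ * √(∫ x in Ω, η x ^ 2) := by
  refine (abs_integral_mul_le_sqrt (Lp.memLp g) hη).trans (le_of_eq ?_)
  rw [← norm_sq_Lp_two, Real.sqrt_sq (norm_nonneg _)]

lemma abs_setIntegral_mul_test_le (g : L2 Ω) {η : Plane → ℝ} (hη : IsTestFunction Ω η) :
    |∫ x in Ω, g x * η x| ≤ ‖g‖ * √(∫ x, η x ^ 2) := by
  refine (abs_setIntegral_mul_le g hη.memLp).trans ?_
  exact mul_le_mul_of_nonneg_left (Real.sqrt_le_sqrt hη.setIntegral_sq_le) (norm_nonneg _)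

lemma dirD_eq_sum (a : Plane) (ψ : Plane → ℝ) (x : Plane) :
    dirD a ψ x = ∑ i, a i * partialD i ψ x := by
  have h : a = ∑ i, a i • EuclideanSpace.single i (1 : ℝ) := by
    ext j
    fin_cases j <;> simp
  conv_lhs => rw [dirD, h]
  simp [partialD]

lemma setIntegral_mul_dirD (g : L2 Ω) (a : Plane) {ψ : Plane → ℝ} (hψ : IsTestFunction Ω ψ) :
    ∫ x in Ω, g x * dirD a ψ x = ∑ i, a i * ∫ x in Ω, g x * partialD i ψ x := by
  simp_rw [← integral_const_mul]
  rw [← integral_finsetSum]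
  · refine integral_congr_ae (ae_of_all _ fun x => ?_)
    simp only [dirD_eq_sum, Finset.mul_sum]
    exact Finset.sum_congr rfl fun i _ => by ring
  · exact fun i _ => ((Lp.memLp g).integrable_mul (hψ.partialD i).memLp).const_mul _

lemma abs_apply_le_norm (a : Plane) (i : Fin 2) : |a i| ≤ ‖a‖ := PiLp.norm_apply_le a i

/-- Second directional derivatives act on `H²(Ω)` by duality. -/
lemma abs_setIntegral_dirD_dirD_le (v : H2 Ω) (a : Plane) {ψ : Plane → ℝ}
    (hψ : IsTestFunction Ω ψ) :
    |∫ x in Ω, H2.fn v x * dirD a (dirD a ψ) x| ≤ 4 * ‖a‖ ^ 2 * ‖v‖ * √(∫ x, ψ x ^ 2) := by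
  -- Both derivatives move onto `v` by definition of weak derivatives; `ψ` has compact support in
  -- `Ω`, so `v` needs no boundary condition.
  have h1 : ∀ i, ∫ x in Ω, H2.fn v x * partialD i (dirD a ψ) x
      = ∑ j, a j * ∫ x in Ω, H2.hess v i j x * ψ x := by
    intro i
    rw [show ∫ x in Ω, H2.fn v x * partialD i (dirD a ψ) x
      = -∫ x in Ω, H2.grad v i x * dirD a ψ x from v.2.1 i _ (hψ.dirD a),
      setIntegral_mul_dirD _ _ hψ, ← Finset.sum_neg_distrib]
    refine Finset.sum_congr rfl fun j _ => ?_
    rw [show ∫ x in Ω, H2.grad v i x * partialD j ψ x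
      = -∫ x in Ω, H2.hess v i j x * ψ x from v.2.2 i j _ hψ]
    ring
  have h2 : ∀ i j, |a i * (a j * ∫ x in Ω, H2.hess v i j x * ψ x)|
      ≤ ‖a‖ * (‖a‖ * (‖v‖ * √(∫ x, ψ x ^ 2))) := by
    intro i j
    rw [abs_mul, abs_mul]
    gcongr
    · exact abs_apply_le_norm a i
    · exact abs_apply_le_norm a j
    · refine (abs_setIntegral_mul_test_le _ hψ).trans ?_
      gcongr
      exact H2.norm_hess_le v i j
  rw [setIntegral_mul_dirD _ _ (hψ.dirD a)]
  simp_rw [h1, Finset.mul_sum]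
  refine (Finset.abs_sum_le_sum_abs _ _).trans ?_
  calc _ ≤ ∑ _i : Fin 2, ∑ _j : Fin 2, ‖a‖ * (‖a‖ * (‖v‖ * √(∫ x, ψ x ^ 2))) :=
        Finset.sum_le_sum fun i _ => (Finset.abs_sum_le_sum_abs _ _).trans
          (Finset.sum_le_sum fun j _ => h2 i j)
    _ = _ := by simp; ring

/-- A cutoff of an `H²(Ω)` function, extended by zero. -/
noncomputable def cutoff (χ : Plane → ℝ) (φ : H2 Ω) : Plane → ℝ :=
  Ω.indicator fun x => χ x * H2.fn φ x

lemma memLp_cutoff (hΩ : MeasurableSet Ω) {χ : Plane → ℝ} (hχ : IsTestFunction univ χ)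
    (φ : H2 Ω) : MemLp (cutoff χ φ) 2 := by
  rw [cutoff, memLp_indicator_iff_restrict hΩ]
  obtain ⟨A, hA⟩ := hχ.1.continuous.bounded_above_of_compact_support hχ.2.1
  exact (Lp.memLp (H2.fn φ)).of_le_mul (c := A)
    (hχ.1.continuous.aestronglyMeasurable.mul (Lp.aestronglyMeasurable _))
    (ae_of_all _ fun x => by rw [norm_mul]; gcongr; exact hA x)

lemma IsTestFunction.mul {U V : Set Plane} {χ ψ : Plane → ℝ} (hχ : IsTestFunction U χ)
    (hψ : IsTestFunction V ψ) : IsTestFunction V fun x => χ x * ψ x :=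
  ⟨hχ.1.mul hψ.1, hψ.2.1.mul_left, (tsupport_mul_subset_right).trans hψ.2.2⟩

/-- First derivatives act on a cutoff of an `H²(Ω)` function by duality. -/
lemma exists_abs_integral_cutoff_dirD_le (hΩ : MeasurableSet Ω) {χ : Plane → ℝ}
    (hχ : IsTestFunction univ χ) (φ : H2 Ω) : ∃ C, 0 ≤ C ∧ ∀ ψ, IsTestFunction Ω ψ → ∀ z,
      |∫ x, cutoff χ φ x * dirD z ψ x| ≤ C * ‖z‖ * √(∫ x, ψ x ^ 2) := by
  obtain ⟨A, hA⟩ := hχ.1.continuous.bounded_above_of_compact_support hχ.2.1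
  have hA0 : 0 ≤ A := (norm_nonneg _).trans (hA 0)
  have hB : ∀ i, ∃ B, ∀ x, ‖partialD i χ x‖ ≤ B := fun i =>
    (hχ.partialD i).1.continuous.bounded_above_of_compact_support (hχ.partialD i).2.1
  choose B hB using hB
  have hB0 : ∀ i, 0 ≤ B i := fun i => (norm_nonneg _).trans (hB i 0)
  refine ⟨∑ i, (A + B i) * ‖φ‖, Finset.sum_nonneg fun i _ => by have := hB0 i; positivity,
    fun ψ hψ z => ?_⟩
  have hbd : ∀ (g : L2 Ω) {θ : Plane → ℝ} {M : ℝ}, ‖g‖ ≤ ‖φ‖ → IsTestFunction univ θ → 0 ≤ M →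
      (∀ x, ‖θ x‖ ≤ M) → |∫ x in Ω, g x * (θ x * ψ x)| ≤ M * ‖φ‖ * √(∫ x, ψ x ^ 2) := by
    intro g θ M hg hθ hM0 hM
    refine (abs_setIntegral_mul_test_le g (hθ.mul hψ)).trans ?_
    have h : √(∫ x, (θ x * ψ x) ^ 2) ≤ M * √(∫ x, ψ x ^ 2) := by
      rw [← Real.sqrt_sq hM0, ← Real.sqrt_mul (sq_nonneg M),
        ← integral_const_mul]
      refine Real.sqrt_le_sqrt (integral_mono (hθ.mul hψ).memLp_volume.integrable_sq
        (hψ.memLp_volume.integrable_sq.const_mul _) fun x => ?_)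
      simp only [mul_pow]
      refine mul_le_mul_of_nonneg_right ?_ (sq_nonneg _)
      rw [← sq_abs]
      exact pow_le_pow_left₀ (abs_nonneg _) (hM x) 2
    calc _ ≤ ‖φ‖ * (M * √(∫ x, ψ x ^ 2)) := by gcongr
      _ = _ := by ring
  -- The weak derivative of `φ` is tested with `χ ψ`. The gradient of `φ` accounts for `A` and the
  -- derivative of `χ` for `B i`.
  have hpart : ∀ i, ∫ x in Ω, H2.fn φ x * (χ x * partialD i ψ x)
      = -(∫ x in Ω, H2.grad φ i x * (χ x * ψ x))
        - ∫ x in Ω, H2.fn φ x * (partialD i χ x * ψ x) := by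
    intro i
    have hprod : ∀ x, partialD i (fun x => χ x * ψ x) x
        = χ x * partialD i ψ x + partialD i χ x * ψ x := fun x => by
      rw [partialD, fderiv_fun_mul (hχ.differentiable x) (hψ.differentiable x)]
      simp [partialD, mul_comm]
    have h1 := φ.2.1 i _ (hχ.mul hψ)
    have h2 : ∫ x in Ω, H2.fn φ x * partialD i (fun x => χ x * ψ x) x
        = (∫ x in Ω, H2.fn φ x * (χ x * partialD i ψ x))
          + ∫ x in Ω, H2.fn φ x * (partialD i χ x * ψ x) := by
      refine Eq.trans (integral_congr_ae (ae_of_all _ fun x => ?_)) (integral_add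
        ((Lp.memLp (H2.fn φ)).integrable_mul (hχ.mul (hψ.partialD i)).memLp)
        ((Lp.memLp (H2.fn φ)).integrable_mul ((hχ.partialD i).mul hψ).memLp))
      simp only [hprod]
      ring
    have h3 : ∫ x in Ω, H2.fn φ x * partialD i (fun x => χ x * ψ x) x
      = -∫ x in Ω, H2.grad φ i x * (χ x * ψ x) := h1
    linarith
  have hone : ∀ i, |∫ x in Ω, H2.fn φ x * (χ x * partialD i ψ x)|
      ≤ (A + B i) * ‖φ‖ * √(∫ x, ψ x ^ 2) := by
    intro i
    rw [hpart, neg_sub_left, abs_neg]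
    refine (abs_add_le _ _).trans ?_
    have := hbd _ (H2.norm_grad_le φ i) hχ hA0 hA
    have := hbd _ (H2.norm_fn_le φ) (hχ.partialD i) (hB0 i) (hB i)
    linarith
  have e : ∫ x, cutoff χ φ x * dirD z ψ x
      = ∑ i, z i * ∫ x in Ω, H2.fn φ x * (χ x * partialD i ψ x) := by
    have e1 : ∫ x, cutoff χ φ x * dirD z ψ x = ∫ x in Ω, χ x * H2.fn φ x * dirD z ψ x := by
      rw [← integral_indicator hΩ]
      exact integral_congr_ae (ae_of_all _ fun x => (indicator_mul_left _ _ _).symm)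
    rw [e1]
    simp_rw [← integral_const_mul]
    rw [← integral_finsetSum]
    · refine integral_congr_ae (ae_of_all _ fun x => ?_)
      simp only [dirD_eq_sum, Finset.mul_sum]
      exact Finset.sum_congr rfl fun i _ => by ring
    · exact fun i _ =>
        ((Lp.memLp (H2.fn φ)).integrable_mul (hχ.mul (hψ.partialD i)).memLp).const_mul _
  rw [e, Finset.sum_mul, Finset.sum_mul]
  refine (Finset.abs_sum_le_sum_abs _ _).trans (Finset.sum_le_sum fun i _ => ?_)
  rw [abs_mul]
  calc _ ≤ ‖z‖ * ((A + B i) * ‖φ‖ * √(∫ x, ψ x ^ 2)) := by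
        gcongr
        · exact abs_apply_le_norm z i
        · exact hone i
    _ = _ := by ring

end

/-! ### Half a derivative for functions extended by zero -/

section

open scoped ContDiff Convolution Pointwise

variable {Ω S : Set Plane} {e : Plane ≃L[ℝ] ℝ × ℝ} {f k : Plane → ℝ} {ρ : ℝ}

lemma exists_norm_le_of_isTestFunction {U : Set Plane} {K : Plane → ℝ} (hK : IsTestFunction U K) :
    ∃ R, ∀ z ∈ tsupport K, ‖z‖ ≤ R :=
  hK.2.1.isCompact.isBounded.exists_norm_le

lemma norm_le_of_mem_tsupport_scale {K : Plane → ℝ} {ε R : ℝ} (hε : 0 < ε)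
    (hR : ∀ z ∈ tsupport K, ‖z‖ ≤ R) {z : Plane} (hz : z ∈ tsupport (scale ε K)) :
    ‖z‖ ≤ ε * R := by
  obtain ⟨w, hw, rfl⟩ := tsupport_scale_subset hε hz
  rw [norm_smul, Real.norm_of_nonneg hε.le]
  exact mul_le_mul_of_nonneg_left (hR w hw) hε.le

/-- A crude bound for arbitrary shifts, used where no smallness is needed. -/
lemma shiftSq_le (hf : MemLp f 2) (z : Plane) : shiftSq f z ≤ 4 * ∫ x, f x ^ 2 := by
  have h1 : Integrable fun x => f (x - z) ^ 2 := (memLp_comp_sub hf z).integrable_sq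
  have h2 : ∫ x, f (x - z) ^ 2 = ∫ x, f x ^ 2 :=
    integral_sub_right_eq_self (fun x => f x ^ 2) z
  calc shiftSq f z ≤ ∫ x, (2 * f (x - z) ^ 2 + 2 * f x ^ 2) :=
        integral_mono (memLp_shift hf z).integrable_sq
          ((h1.const_mul 2).add (hf.integrable_sq.const_mul 2)) fun x => by
            nlinarith [sq_nonneg (f (x - z) + f x)]
    _ = _ := by
        rw [integral_add (h1.const_mul 2) (hf.integrable_sq.const_mul 2), integral_const_mul,
          integral_const_mul, h2]
        ring

/-- As a function of the shift, a test function paired with `f` is Lipschitz. -/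
lemma abs_integral_mul_sub_shift_le (hf : LocallyIntegrable f) {C : ℝ}
    (hC : ∀ ψ, IsTestFunction Ω ψ → ∀ z,
      |∫ x, f x * dirD z ψ x| ≤ C * ‖z‖ * √(∫ x, ψ x ^ 2))
    {ψ : Plane → ℝ} {z : Plane}
    (hψ : ∀ s ∈ Icc (0 : ℝ) 1, IsTestFunction Ω fun x => ψ (x - s • z)) :
    |(∫ x, f x * ψ (x - z)) - ∫ x, f x * ψ x| ≤ C * ‖z‖ * √(∫ x, ψ x ^ 2) := by
  have hψ0 : IsTestFunction Ω ψ := by simpa using hψ 0 ⟨le_rfl, zero_le_one⟩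
  -- After reflection the pairing with the shifted `ψ` is a convolution, hence differentiable in the
  -- shift; the mean value inequality along the segment from `0` to `z` concludes.
  set η : Plane → ℝ := fun y => ψ (-y) with hη
  have hηc : ContDiff ℝ ∞ η := hψ0.1.comp contDiff_neg
  have hηs : HasCompactSupport η := hψ0.2.1.comp_homeomorph (Homeomorph.neg Plane)
  have hconv : ∀ w, conv f η w = ∫ x, f x * ψ (x - w) := fun w => by
    simp [conv, convolution_lsmul, hη]
  have hdir : ∀ w y, dirD z η (w - y) = -dirD z (fun x => ψ (x - w)) y := by
    intro w y
    have h1 : HasFDerivAt η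
        ((fderiv ℝ ψ (-(w - y))).comp (-ContinuousLinearMap.id ℝ Plane)) (w - y) :=
      (hψ0.differentiable _).hasFDerivAt.comp _ (hasFDerivAt_id _).neg
    have h2 : HasFDerivAt (fun x => ψ (x - w))
        ((fderiv ℝ ψ (y - w)).comp (ContinuousLinearMap.id ℝ Plane)) y :=
      (hψ0.differentiable _).hasFDerivAt.comp _ ((hasFDerivAt_id _).sub_const w)
    rw [dirD, dirD, h1.fderiv, h2.fderiv]
    simp
  have hderiv : ∀ s : ℝ, HasDerivAt (fun s : ℝ => conv f η (s • z))
      (-∫ x, f x * dirD z (fun x => ψ (x - s • z)) x) s := by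
    intro s
    have hd : Differentiable ℝ (conv f η) :=
      (hηs.contDiff_convolution_right (ContinuousLinearMap.lsmul ℝ ℝ) hf hηc).differentiable
        (by simp)
    have h := (hd (s • z)).hasFDerivAt.comp_hasDerivAt s ((hasDerivAt_id s).smul_const z)
    have e1 : fderiv ℝ (conv f η) (s • z) ((1 : ℝ) • z)
        = -∫ x, f x * dirD z (fun x => ψ (x - s • z)) x := by
      have := congrFun (dirD_conv hf hηc hηs z) (s • z)
      rw [one_smul]
      refine Eq.trans this ?_
      simp only [conv, convolution_lsmul, smul_eq_mul, hdir, mul_neg, integral_neg]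
    rw [← e1]
    exact h
  have hbound : ∀ s ∈ Ico (0 : ℝ) 1, ‖-∫ x, f x * dirD z (fun x => ψ (x - s • z)) x‖
      ≤ C * ‖z‖ * √(∫ x, ψ x ^ 2) := by
    intro s hs
    rw [norm_neg, Real.norm_eq_abs]
    refine (hC _ (hψ s ⟨hs.1, hs.2.le⟩) z).trans (le_of_eq ?_)
    rw [integral_sub_right_eq_self (fun x => ψ x ^ 2) (s • z)]
  have h := norm_image_sub_le_of_norm_deriv_le_segment_01'
    (fun s _ => (hderiv s).hasDerivWithinAt) hbound
  simpa [hconv] using h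

/-- Convolutions with small kernels converge in `L²`. -/
lemma tendsto_conv_scale (hf : MemLp f 2) (hk : IsTestFunction (openCone e) k)
    (hk1 : ∫ z, k z = 1) {ε : ℕ → ℝ} (hε0 : ∀ n, 0 < ε n) (hε : Tendsto ε atTop (𝓝 0)) :
    Tendsto (fun n => ∫ x, (conv f (scale (ε n) k) x - f x) ^ 2) atTop (𝓝 0) := by
  obtain ⟨R, hR⟩ := exists_norm_le_of_isTestFunction hk
  rw [Metric.tendsto_nhds]
  intro η hη
  set I := ∫ z, |k z|
  have hI : 0 ≤ I := integral_nonneg fun _ => abs_nonneg _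
  set D := η / (2 * (I ^ 2 + 1)) with hD
  have hD0 : 0 < D := by positivity
  obtain ⟨r, hr, hr'⟩ := Metric.eventually_nhds_iff.1
    ((tendsto_shiftSq hf).eventually_le_const hD0)
  have hev : ∀ᶠ n in atTop, ε n * R < r := by
    have : Tendsto (fun n => ε n * R) atTop (𝓝 0) := by simpa using hε.mul_const R
    exact this.eventually_lt_const hr
  filter_upwards [hev] with n hn
  have hs := hk.scale (hε0 n)
  have h := (integral_conv_sub_sq_le hf hs.1.continuous hs.2.1
    (by rw [integral_scale (hε0 n), hk1]) hD0.le fun z hz => hr' (by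
      rw [dist_zero_right]
      exact (norm_le_of_mem_tsupport_scale (hε0 n) hR (subset_tsupport _ hz)).trans_lt hn)).2
  rw [integral_abs_scale (hε0 n)] at h
  rw [Real.dist_eq, sub_zero, abs_of_nonneg (integral_nonneg fun _ => sq_nonneg _)]
  refine h.trans_lt ?_
  rw [hD, div_mul_eq_mul_div, div_lt_iff₀ (by positivity)]
  have : 0 ≤ I ^ 2 := sq_nonneg I
  change η * I ^ 2 < _
  nlinarith

lemma add_tsupport_subset {K : Plane → ℝ} (hK : IsTestFunction (openCone e) K) {r : ℝ}
    (hKr : ∀ z ∈ tsupport K, ‖z‖ < r)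
    (hS : ∀ x ∈ S, ∀ z ∈ openCone e, ‖z‖ < r → x + z ∈ Ω) : S + tsupport K ⊆ Ω := by
  rintro _ ⟨x, hx, z, hz, rfl⟩
  exact hS x hx z (hK.2.2 hz) (hKr z hz)

/-- Half a derivative of regularity across the boundary, in the directions of the cone. -/
lemma shiftSq_le_norm (hf : MemLp f 2) (hScomp : IsCompact S) (hfS : Function.support f ⊆ S)
    (hρ : 0 < ρ) (hS : ∀ x ∈ S, ∀ z ∈ openCone e, ‖z‖ < ρ → x + z ∈ Ω)
    (hk : IsTestFunction (openCone e) k) (hk1 : ∫ z, k z = 1) {C : ℝ}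
    (hC : ∀ ψ, IsTestFunction Ω ψ → ∀ z,
      |∫ x, f x * dirD z ψ x| ≤ C * ‖z‖ * √(∫ x, ψ x ^ 2))
    {z : Plane} (hz : z ∈ openCone e) (hzρ : ‖z‖ < ρ / 2) :
    shiftSq f z ≤ 2 * C * √(∫ x, f x ^ 2) * ‖z‖ := by
  have hfl : LocallyIntegrable f := hf.locallyIntegrable (by norm_num)
  obtain ⟨R, hR⟩ := exists_norm_le_of_isTestFunction hk
  set ε : ℕ → ℝ := fun n => ((n : ℝ) + 1)⁻¹ with hεdef
  have hε0 : ∀ n, 0 < ε n := fun n => by positivity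
  have hε : Tendsto ε atTop (𝓝 0) := by
    simpa [hεdef, one_div] using tendsto_one_div_add_atTop_nhds_zero_nat (𝕜 := ℝ)
  -- The aim is to pair `f` with its own increment. Since `f` is not a test function, the second
  -- copy is replaced by these inward mollifications.
  set ψ : ℕ → Plane → ℝ := fun n => conv f (scale (ε n) k) with hψ
  have hmem : ∀ n, MemLp (ψ n) 2 := fun n => by
    have hs := hk.scale (hε0 n)
    have h := (integral_conv_sub_sq_le hf hs.1.continuous hs.2.1
      (by rw [integral_scale (hε0 n), hk1]) (D := 4 * ∫ x, f x ^ 2) (by positivity)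
      fun z _ => shiftSq_le hf z).1
    refine (memLp_congr_ae (ae_of_all _ fun x => ?_)).1 (h.add hf)
    simp [hψ]
  have hconv : Tendsto (fun n => (hmem n).toLp (ψ n)) atTop (𝓝 (hf.toLp f)) := by
    rw [tendsto_iff_norm_sub_tendsto_zero]
    have h := (tendsto_conv_scale hf hk hk1 hε0 hε).sqrt
    rw [Real.sqrt_zero] at h
    refine h.congr fun n => ?_
    rw [← MemLp.toLp_sub, ← Real.sqrt_sq (norm_nonneg (MemLp.toLp _ _)), norm_sq_toLp]
    rfl
  have hev : ∀ᶠ n in atTop, |inner ℝ (hf.toLp f - (memLp_comp_sub hf (-z)).toLp _)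
      ((hmem n).toLp (ψ n))| ≤ C * ‖z‖ * ‖(hmem n).toLp (ψ n)‖ := by
    have hlim : ∀ᶠ n in atTop, ε n * R < ρ / 2 := by
      have : Tendsto (fun n => ε n * R) atTop (𝓝 0) := by simpa using hε.mul_const R
      exact this.eventually_lt_const (by positivity)
    filter_upwards [hlim] with n hn
    have hs := hk.scale (hε0 n)
    have hKR : ∀ y ∈ tsupport (scale (ε n) k), ‖y‖ < ρ / 2 := fun y hy =>
      (norm_le_of_mem_tsupport_scale (hε0 n) hR hy).trans_lt hn
    have hψS : IsTestFunction (S + tsupport (scale (ε n) k)) (ψ n) :=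
      isTestFunction_conv hfl hScomp hfS hs.1 hs.2.1 subset_rfl
    -- Mollification and shift each move points of `S` by less than `ρ / 2` within the cone, so the
    -- total displacement is admissible.
    have htest : ∀ s ∈ Icc (0 : ℝ) 1, IsTestFunction Ω fun x => ψ n (x - s • z) := by
      intro s hs'
      refine ⟨hψS.1.comp (contDiff_id.sub contDiff_const),
        hψS.2.1.comp_homeomorph (Homeomorph.subRight (s • z)), fun x hx => ?_⟩
      have hx' : x - s • z ∈ tsupport (ψ n) :=
        tsupport_comp_subset_preimage (ψ n) (f := fun x => x - s • z) (by fun_prop) hx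
      obtain ⟨y, hy, w, hw, hyw⟩ := hψS.2.2 hx'
      have hyw' : y + w = x - s • z := hyw
      have e1 : x = y + (w + s • z) := by rw [← add_assoc, hyw']; abel
      have hwn := hKR w hw
      have hsz : ‖s • z‖ ≤ ‖z‖ := by
        rw [norm_smul, Real.norm_of_nonneg hs'.1]
        exact mul_le_of_le_one_left (norm_nonneg _) hs'.2
      rw [e1]
      refine hS y hy _ ?_ ((norm_add_le _ _).trans_lt (by linarith))
      -- The open cone does not contain `0`, so `s = 0` is treated apart.
      rcases hs'.1.eq_or_lt with h0 | h0
      · simpa [← h0] using hs.2.2 hw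
      · exact add_mem_openCone (hs.2.2 hw) (smul_mem_openCone h0 hz)
    have key := abs_integral_mul_sub_shift_le hfl hC htest
    have e2 : inner ℝ (hf.toLp f - (memLp_comp_sub hf (-z)).toLp _) ((hmem n).toLp (ψ n))
        = -((∫ x, f x * ψ n (x - z)) - ∫ x, f x * ψ n x) := by
      have h1 : ∫ x, f x * ψ n (x - z) = ∫ x, f (x + z) * ψ n x := by
        rw [← integral_add_right_eq_self (fun x => f x * ψ n (x - z)) z]
        simp
      have i1 : Integrable fun x => f (x + z) * ψ n x := by
        simpa using! (memLp_comp_sub hf (-z)).integrable_mul (hmem n)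
      have i2 : Integrable fun x => f x * ψ n x := hf.integrable_mul (hmem n)
      rw [h1, neg_sub, ← integral_sub i2 i1, ← MemLp.toLp_sub, L2.inner_def]
      refine integral_congr_ae ?_
      filter_upwards [(hf.sub (memLp_comp_sub hf (-z))).coeFn_toLp, (hmem n).coeFn_toLp]
        with x h1 h2
      rw [h1, h2]
      simp
      ring
    rw [e2, abs_neg]
    refine key.trans (le_of_eq ?_)
    rw [← norm_sq_toLp (hmem n), Real.sqrt_sq (norm_nonneg _)]
  have hlim := le_of_tendsto_of_tendsto
    ((tendsto_const_nhds.inner hconv).abs) (hconv.norm.const_mul (C * ‖z‖)) hev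
  have e3 : inner ℝ (hf.toLp f - (memLp_comp_sub hf (-z)).toLp _) (hf.toLp f)
      = (∫ x, f x ^ 2) - ∫ x, f (x + z) * f x := by
    have i1 : Integrable fun x => f (x + z) * f x := by
      simpa using! (memLp_comp_sub hf (-z)).integrable_mul hf
    rw [← integral_sub hf.integrable_sq i1, ← MemLp.toLp_sub, L2.inner_def]
    refine integral_congr_ae ?_
    filter_upwards [(hf.sub (memLp_comp_sub hf (-z))).coeFn_toLp, hf.coeFn_toLp] with x h1 h2
    rw [h1, h2]
    simp
    ring
  -- Expanding the square turns the squared increment into a pairing that is linear in the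
  -- increment. A bound linear in `‖z‖` for the square is half a derivative.
  have e4 : shiftSq f z = 2 * ((∫ x, f x ^ 2) - ∫ x, f (x + z) * f x) := by
    have h2 : ∫ x, f (x - z) ^ 2 = ∫ x, f x ^ 2 :=
      integral_sub_right_eq_self (fun x => f x ^ 2) z
    have h3 : ∫ x, f (x + z) * f x = ∫ x, f x * f (x - z) := by
      rw [← integral_add_right_eq_self (fun x => f x * f (x - z)) z]
      simp
    have i1 : Integrable fun x => f (x - z) ^ 2 := (memLp_comp_sub hf z).integrable_sq
    have i2 : Integrable fun x => f x * f (x - z) := hf.integrable_mul (memLp_comp_sub hf z)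
    have e5 : shiftSq f z = ∫ x, (f (x - z) ^ 2 + f x ^ 2 - 2 * (f x * f (x - z))) :=
      integral_congr_ae (ae_of_all _ fun x => by ring)
    have i3 : Integrable fun x => f (x - z) ^ 2 + f x ^ 2 := i1.add hf.integrable_sq
    rw [e5, integral_sub i3 (i2.const_mul 2),
      integral_add i1 hf.integrable_sq, integral_const_mul, h2, h3]
    ring
  rw [e3, ← Real.sqrt_sq (norm_nonneg (hf.toLp f)), norm_sq_toLp] at hlim
  rw [e4]
  linarith [le_abs_self ((∫ x, f x ^ 2) - ∫ x, f (x + z) * f x)]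

end

/-! ### Approximation by test functions at scales `16^{-n}` -/

section

open scoped ContDiff Convolution Pointwise

variable {Ω S : Set Plane} {e : Plane ≃L[ℝ] ℝ × ℝ} {f K : Plane → ℝ} {ρ : ℝ}

/-- Young's inequality, up to a constant. -/
lemma integral_conv_sq_le (hf : MemLp f 2) (hK : Continuous K) (hKs : HasCompactSupport K) :
    ∫ x, conv f K x ^ 2 ≤ 10 * (∫ x, f x ^ 2) * (∫ z, |K z|) ^ 2 := by
  have hfl : LocallyIntegrable f := hf.locallyIntegrable (by norm_num)
  have hF : 0 ≤ ∫ x, f x ^ 2 := integral_nonneg fun _ => sq_nonneg _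
  -- Writing `f * K = (f * K - c f) + c f` with `c = ∫ K` gives the constant `10 = 2 · 4 + 2`.
  obtain ⟨h1, h2⟩ := memLp_average hf hK hKs (D := 4 * ∫ x, f x ^ 2) (by positivity)
    fun z _ => shiftSq_le hf z
  simp only [integral_shift_mul hfl hK hKs] at h1 h2
  set c := ∫ z, K z
  have hc : c ^ 2 ≤ (∫ z, |K z|) ^ 2 := by
    rw [← sq_abs c]
    exact pow_le_pow_left₀ (abs_nonneg _) (abs_integral_le_integral_abs) 2
  have i1 : Integrable fun x => (conv f K x - f x * c) ^ 2 := h1.integrable_sq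
  have i2 : Integrable fun x => f x ^ 2 := hf.integrable_sq
  calc ∫ x, conv f K x ^ 2
      ≤ ∫ x, (2 * (conv f K x - f x * c) ^ 2 + 2 * c ^ 2 * f x ^ 2) := by
        refine integral_mono_of_nonneg (ae_of_all _ fun _ => sq_nonneg _)
          ((i1.const_mul 2).add (i2.const_mul _)) (ae_of_all _ fun x => ?_)
        simp only
        nlinarith [sq_nonneg (conv f K x - 2 * (f x * c))]
    _ = 2 * (∫ x, (conv f K x - f x * c) ^ 2) + 2 * c ^ 2 * ∫ x, f x ^ 2 := by
        rw [integral_add (i1.const_mul 2) (i2.const_mul _), integral_const_mul,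
          integral_const_mul]
    _ ≤ _ := by nlinarith

lemma setIntegral_mul_sub (g : L2 Ω) {η θ : Plane → ℝ} (hη : MemLp η 2 (volume.restrict Ω))
    (hθ : MemLp θ 2 (volume.restrict Ω)) :
    (∫ x in Ω, g x * η x) - ∫ x in Ω, g x * θ x = ∫ x in Ω, g x * (η x - θ x) := by
  refine (integral_sub ((Lp.memLp g).integrable_mul hη)
    ((Lp.memLp g).integrable_mul hθ)).symm.trans (integral_congr_ae (ae_of_all _ fun x => ?_))
  simp only [Pi.mul_apply]
  ring

lemma conv_const_mul (f K : Plane → ℝ) (c : ℝ) (x : Plane) :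
    conv f (fun z => c * K z) x = c * conv f K x := by
  simp only [conv_apply, ← integral_const_mul]
  exact integral_congr_ae (ae_of_all _ fun z => by ring)

lemma conv_add (hf : LocallyIntegrable f) {K L : Plane → ℝ} (hK : Continuous K)
    (hKs : HasCompactSupport K) (hL : Continuous L) (hLs : HasCompactSupport L) (x : Plane) :
    conv f (fun z => K z + L z) x = conv f K x + conv f L x := by
  simp only [conv_apply]
  rw [← integral_add (integrable_conv_integrand hf hK hKs x)
    (integrable_conv_integrand hf hL hLs x)]
  exact integral_congr_ae (ae_of_all _ fun z => by ring)

/-- The size of the second derivatives of a convolution with a dilated kernel. -/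
lemma integral_conv_dirD_dirD_sq_le (hf : MemLp f 2) (hK : IsTestFunction (openCone e) K)
    {ε R B : ℝ} (hε : 0 < ε) (hR0 : 0 ≤ R) (hB : 0 ≤ B) (hR : ∀ z ∈ tsupport K, ‖z‖ ≤ R)
    (hs : ∀ z ∈ openCone e, ‖z‖ ≤ ε * R → shiftSq f z ≤ B * ‖z‖) (v w : Plane) :
    ∫ x, dirD w (dirD v (conv f (scale ε K))) x ^ 2
      ≤ B * R * (∫ z, |dirD w (dirD v K) z|) ^ 2 * (ε⁻¹) ^ 3 := by
  have hfl : LocallyIntegrable f := hf.locallyIntegrable (by norm_num)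
  have hKε := hK.scale hε
  have h2 := (hK.dirD v).dirD w
  have h2ε := h2.scale hε
  have e1 : ∀ x, dirD w (dirD v (conv f (scale ε K))) x
      = ε⁻¹ ^ 2 * conv f (scale ε (dirD w (dirD v K))) x := by
    intro x
    rw [dirD_conv hfl hKε.1 hKε.2.1, dirD_conv hfl (hKε.dirD v).1 (hKε.dirD v).2.1,
      dirD_scale hK.differentiable, dirD_const_mul _ ((hK.dirD v).scale hε).differentiable,
      dirD_scale (hK.dirD v).differentiable, conv_const_mul, conv_const_mul]
    ring
  have hsupp : ∀ z ∈ Function.support (scale ε (dirD w (dirD v K))), shiftSq f z ≤ B * (ε * R) := by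
    intro z hz
    have hz' := subset_tsupport _ hz
    have hn : ‖z‖ ≤ ε * R := norm_le_of_mem_tsupport_scale hε
      (fun y hy => hR y ((tsupport_fderiv_apply_subset ℝ v) ((tsupport_fderiv_apply_subset ℝ w) hy)))
      hz'
    exact (hs z (h2ε.2.2 hz') hn).trans (by gcongr)
  -- A derivative of a kernel has mean zero, so the convolution only sees increments of `f`, whose
  -- squares are of order `ε`. Against `ε^{-4}` from two derivatives this leaves `ε^{-3}`.
  have key := integral_conv_sq_le_of_integral_eq_zero hf h2ε.1.continuous h2ε.2.1
    (by rw [integral_scale hε, integral_dirD_eq_zero (hK.dirD v)]) (by positivity) hsupp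
  rw [integral_abs_scale hε] at key
  simp only [e1, mul_pow]
  rw [integral_const_mul]
  calc _ ≤ (ε⁻¹ ^ 2) ^ 2 * (B * (ε * R) * (∫ z, |dirD w (dirD v K) z|) ^ 2) := by gcongr
    _ = _ := by field_simp

/-- For first derivatives Young's inequality suffices: `ε^{-2}` is already below the `ε^{-3}` of the
second derivatives. -/
lemma integral_conv_dirD_sq_le (hf : MemLp f 2) (hK : IsTestFunction (openCone e) K)
    {ε : ℝ} (hε : 0 < ε) (v : Plane) :
    ∫ x, dirD v (conv f (scale ε K)) x ^ 2
      ≤ 10 * (∫ x, f x ^ 2) * (∫ z, |dirD v K z|) ^ 2 * (ε⁻¹) ^ 2 := by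
  have hfl : LocallyIntegrable f := hf.locallyIntegrable (by norm_num)
  have hKε := hK.scale hε
  have h1ε := (hK.dirD v).scale hε
  have e1 : ∀ x, dirD v (conv f (scale ε K)) x = ε⁻¹ * conv f (scale ε (dirD v K)) x := by
    intro x
    rw [dirD_conv hfl hKε.1 hKε.2.1, dirD_scale hK.differentiable, conv_const_mul]
  have key := integral_conv_sq_le hf h1ε.1.continuous h1ε.2.1
  rw [integral_abs_scale hε] at key
  simp only [e1, mul_pow]
  rw [integral_const_mul, mul_comm]
  gcongr

/-- Approximation by test functions of a function cut off near the boundary, at dyadic scales. -/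
lemma exists_approx (hf : MemLp f 2) (hScomp : IsCompact S) (hfS : Function.support f ⊆ S)
    (hρ : 0 < ρ) (hS : ∀ x ∈ S, ∀ z ∈ openCone e, ‖z‖ < ρ → x + z ∈ Ω) {C : ℝ} (hC0 : 0 ≤ C)
    (hC : ∀ ψ, IsTestFunction Ω ψ → ∀ z,
      |∫ x, f x * dirD z ψ x| ≤ C * ‖z‖ * √(∫ x, ψ x ^ 2)) :
    ∃ (ψ : ℕ → Plane → ℝ) (hψ : ∀ n, IsTestFunction Ω (ψ n)) (A : ℝ), 0 ≤ A ∧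
      (∀ n, ‖jet (hψ n)‖ ≤ A * 64 ^ n) ∧
      (∀ n (v : H2 Ω), |(∫ x in Ω, H2.fn v x * ψ n x) - ∫ x in Ω, H2.fn v x * ψ (n + 1) x|
        ≤ A * (1 / 256) ^ n * ‖v‖) ∧
      ∀ g : L2 Ω, Tendsto (fun n => ∫ x in Ω, g x * ψ n x) atTop (𝓝 (∫ x in Ω, g x * f x)) := by
  have hfl : LocallyIntegrable f := hf.locallyIntegrable (by norm_num)
  obtain ⟨k, Q₁, Q₂, hk, hQ₁, hQ₂, hk1, hkQ⟩ := exists_kernel e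
  obtain ⟨R, hR0, hRk, hRQ₁, hRQ₂⟩ : ∃ R, 0 ≤ R ∧ (∀ z ∈ tsupport k, ‖z‖ ≤ R) ∧
      (∀ z ∈ tsupport Q₁, ‖z‖ ≤ R) ∧ ∀ z ∈ tsupport Q₂, ‖z‖ ≤ R := by
    obtain ⟨R₁, h1⟩ := exists_norm_le_of_isTestFunction hk
    obtain ⟨R₂, h2⟩ := exists_norm_le_of_isTestFunction hQ₁
    obtain ⟨R₃, h3⟩ := exists_norm_le_of_isTestFunction hQ₂
    refine ⟨max 0 (max R₁ (max R₂ R₃)), le_max_left _ _, fun z hz => (h1 z hz).trans ?_,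
      fun z hz => (h2 z hz).trans ?_, fun z hz => (h3 z hz).trans ?_⟩ <;> simp
  -- `ε₀ ≤ 1` lets `ε^{-3}` dominate the lower powers; the other bound keeps all supports in `Ω` and
  -- permits the half-derivative estimate.
  obtain ⟨ε₀, hε₀, hε₁, hεR⟩ : ∃ ε₀ : ℝ, 0 < ε₀ ∧ ε₀ ≤ 1 ∧ ε₀ * R < ρ / 2 := by
    refine ⟨min 1 (ρ / (4 * (R + 1))), by positivity, min_le_left _ _, ?_⟩
    calc min 1 (ρ / (4 * (R + 1))) * R ≤ ρ / (4 * (R + 1)) * R := by gcongr; exact min_le_right _ _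
      _ < ρ / 2 := by
        rw [div_mul_eq_mul_div, div_lt_div_iff₀ (by positivity) (by positivity)]
        nlinarith
  set ε : ℕ → ℝ := fun n => ε₀ * (1 / 16) ^ n with hεdef
  have hε0 : ∀ n, 0 < ε n := fun n => by positivity
  have hεle : ∀ n, ε n ≤ ε₀ := fun n =>
    mul_le_of_le_one_right hε₀.le (pow_le_one₀ (by norm_num) (by norm_num))
  have hεlim : Tendsto ε atTop (𝓝 0) := by
    have h := (tendsto_pow_atTop_nhds_zero_of_lt_one (by norm_num : (0 : ℝ) ≤ 1 / 16)
      (by norm_num)).const_mul ε₀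
    rwa [mul_zero] at h
  have hsmall : ∀ n, ε n * R < ρ / 2 := fun n =>
    (mul_le_mul_of_nonneg_right (hεle n) hR0).trans_lt hεR
  have htest : ∀ n {L : Plane → ℝ}, IsTestFunction (openCone e) L →
      (∀ z ∈ tsupport L, ‖z‖ ≤ R) → IsTestFunction Ω (conv f (scale (ε n) L)) := by
    intro n L hL hLR
    have hs := hL.scale (hε0 n)
    refine isTestFunction_conv hfl hScomp hfS hs.1 hs.2.1 (add_tsupport_subset hs
      (fun z hz => ?_) hS)
    linarith [norm_le_of_mem_tsupport_scale (hε0 n) hLR hz, hsmall n]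
  set F := ∫ x, f x ^ 2 with hF
  have hF0 : 0 ≤ F := integral_nonneg fun _ => sq_nonneg _
  set B := 2 * C * √F
  have hB0 : 0 ≤ B := by positivity
  have hshift : ∀ n, ∀ z ∈ openCone e, ‖z‖ ≤ ε n * R → shiftSq f z ≤ B * ‖z‖ := fun n z hz hzn =>
    shiftSq_le_norm hf hScomp hfS hρ hS hk hk1 hC hz (hzn.trans_lt (hsmall n))
  set ψ : ℕ → Plane → ℝ := fun n => conv f (scale (ε n) k) with hψdef
  have hψ : ∀ n, IsTestFunction Ω (ψ n) := fun n => htest n hk hRk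
  obtain ⟨A₁, hA₁, hjet⟩ : ∃ A₁, 0 ≤ A₁ ∧ ∀ n, ‖jet (hψ n)‖ ≤ A₁ * 64 ^ n := by
    set u : Fin 2 → Plane := fun i => EuclideanSpace.single i (1 : ℝ)
    set a0 := 10 * F * (∫ z, |k z|) ^ 2
    set a1 : Fin 2 → ℝ := fun i => 10 * F * (∫ z, |dirD (u i) k z|) ^ 2
    set a2 : Fin 2 → Fin 2 → ℝ := fun i j => B * R * (∫ z, |dirD (u j) (dirD (u i) k) z|) ^ 2
    have ha1 : ∀ i, 0 ≤ a1 i := fun i => by positivity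
    have ha2 : ∀ i j, 0 ≤ a2 i j := fun i j => by positivity
    set M := (a0 + ∑ i, a1 i + ∑ i, ∑ j, a2 i j) * (ε₀⁻¹) ^ 3 with hM
    have hsum : 0 ≤ a0 + ∑ i, a1 i + ∑ i, ∑ j, a2 i j :=
      add_nonneg (add_nonneg (by positivity) (Finset.sum_nonneg fun i _ => ha1 i))
        (Finset.sum_nonneg fun i _ => Finset.sum_nonneg fun j _ => ha2 i j)
    have hM0 : 0 ≤ M := by positivity
    have hpow : ∀ n, ∀ a, 0 ≤ a → a ≤ a0 + ∑ i, a1 i + ∑ i, ∑ j, a2 i j →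
        a * ((ε n)⁻¹) ^ 3 ≤ (√M * 64 ^ n) ^ 2 := by
      intro n a ha haM
      -- `16³ = 64²`: this is where the growth rate `64^n` comes from.
      have e1 : ((ε n)⁻¹) ^ 3 = (ε₀⁻¹) ^ 3 * (64 ^ n) ^ 2 := by
        simp only [hεdef, mul_inv, mul_pow, one_div, inv_pow, inv_inv]
        rw [← pow_mul, ← pow_mul, mul_comm n 3, mul_comm n 2, pow_mul, pow_mul]
        norm_num
      rw [mul_pow, Real.sq_sqrt hM0, e1, hM, ← mul_assoc]
      gcongr
    have hone : ∀ n, 1 ≤ (ε n)⁻¹ := fun n => (one_le_inv₀ (hε0 n)).2 ((hεle n).trans hε₁)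
    refine ⟨3 * √M, by positivity, fun n => ?_⟩
    rw [mul_assoc]
    have hS1 : 0 ≤ ∑ i, a1 i := Finset.sum_nonneg fun i _ => ha1 i
    have hS2 : 0 ≤ ∑ i, ∑ j, a2 i j := Finset.sum_nonneg fun i _ => Finset.sum_nonneg fun j _ => ha2 i j
    have ha0 : 0 ≤ a0 := by positivity
    refine norm_jet_le (hψ n) (by positivity) ?_ (fun i => ?_) fun i j => ?_
    · have hs := hk.scale (hε0 n)
      refine (integral_conv_sq_le hf hs.1.continuous hs.2.1).trans ?_
      rw [integral_abs_scale (hε0 n)]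
      refine le_trans ?_ (hpow n a0 ha0 (by linarith))
      exact le_mul_of_one_le_right ha0 (one_le_pow₀ (hone n))
    · refine (integral_conv_dirD_sq_le hf hk (hε0 n) (u i)).trans ?_
      refine le_trans ?_ (hpow n (a1 i) (ha1 i) ?_)
      · exact mul_le_mul_of_nonneg_left (pow_le_pow_right₀ (hone n) (by norm_num)) (ha1 i)
      · have := Finset.single_le_sum (fun i _ => ha1 i) (Finset.mem_univ i)
        linarith
    · refine (integral_conv_dirD_dirD_sq_le hf hk (hε0 n) hR0 hB0 hRk (hshift n)
        (u i) (u j)).trans (hpow n (a2 i j) (ha2 i j) ?_)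
      have h1 := Finset.single_le_sum (fun j _ => ha2 i j) (Finset.mem_univ j)
      have h2 := Finset.single_le_sum
        (fun i _ => Finset.sum_nonneg (s := Finset.univ) fun j _ => ha2 i j) (Finset.mem_univ i)
      linarith
  obtain ⟨A₂, hA₂, hinc⟩ : ∃ A₂, 0 ≤ A₂ ∧ ∀ n (v : H2 Ω),
      |(∫ x in Ω, H2.fn v x * ψ n x) - ∫ x in Ω, H2.fn v x * ψ (n + 1) x|
        ≤ A₂ * (1 / 256) ^ n * ‖v‖ := by
    set a := e.symm (1, 0)
    set b := e.symm (0, 1)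
    set q : (Plane → ℝ) → ℝ := fun Q => √(10 * F * (∫ z, |Q z|) ^ 2)
    refine ⟨4 * ‖a‖ ^ 2 * q Q₁ + 4 * ‖b‖ ^ 2 * q Q₂, by positivity, fun n v => ?_⟩
    have hq : ∀ {Q}, IsTestFunction (openCone e) Q →
        √(∫ x, conv f (scale (ε n) Q) x ^ 2) ≤ q Q := fun {Q} hQ => by
      have hs := hQ.scale (hε0 n)
      refine Real.sqrt_le_sqrt ((integral_conv_sq_le hf hs.1.continuous hs.2.1).trans ?_)
      rw [integral_abs_scale (hε0 n)]
    have hT₁ := htest n hQ₁ hRQ₁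
    have hT₂ := htest n hQ₂ hRQ₂
    have hDD : ∀ {Q} (w : Plane), IsTestFunction (openCone e) Q → ∀ x,
        conv f (scale (ε n) (dirD w (dirD w Q))) x
          = ε n ^ 2 * dirD w (dirD w (conv f (scale (ε n) Q))) x := by
      intro Q w hQ x
      have hs := hQ.scale (hε0 n)
      rw [dirD_conv hfl hs.1 hs.2.1, dirD_conv hfl (hs.dirD w).1 (hs.dirD w).2.1,
        dirD_scale hQ.differentiable, dirD_const_mul _ ((hQ.dirD w).scale (hε0 n)).differentiable,
        dirD_scale (hQ.dirD w).differentiable, conv_const_mul, conv_const_mul]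
      have := (hε0 n).ne'
      field_simp
    have hdiff : ∀ x, ψ n x - ψ (n + 1) x
        = ε n ^ 2 * dirD a (dirD a (conv f (scale (ε n) Q₁))) x
          + ε n ^ 2 * dirD b (dirD b (conv f (scale (ε n) Q₂))) x := by
      intro x
      rw [← hDD a hQ₁, ← hDD b hQ₂]
      have s1 := ((hQ₁.dirD a).dirD a).scale (hε0 n)
      have s2 := ((hQ₂.dirD b).dirD b).scale (hε0 n)
      rw [← conv_add hfl s1.1.continuous s1.2.1 s2.1.continuous s2.2.1]
      have e1 : ε (n + 1) = ε n * (1 / 16) := by simp only [hεdef, pow_succ]; ring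
      -- The kernel identity dilated by `ε n`: consecutive scales differ by exactly the ratio `1 /
      -- 16` of the identity.
      have e2 : ∀ z, scale (ε n) k z = scale (ε (n + 1)) k z +
          (scale (ε n) (dirD a (dirD a Q₁)) z + scale (ε n) (dirD b (dirD b Q₂)) z) := by
        intro z
        have := hkQ ((ε n)⁻¹ • z)
        rw [e1, show scale (ε n * (1 / 16)) k = _ from (scale_scale _ _ _).symm,
          ← sub_eq_iff_eq_add']
        exact (mul_sub _ _ _).symm.trans ((congrArg _ this).trans (mul_add _ _ _))
      have hs' := hk.scale (hε0 (n + 1))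
      simp only [hψdef]
      rw [show scale (ε n) k = _ from funext e2, conv_add hfl hs'.1.continuous hs'.2.1
        (L := fun z => scale (ε n) (dirD a (dirD a Q₁)) z + scale (ε n) (dirD b (dirD b Q₂)) z)
        (s1.1.continuous.add s2.1.continuous) (s1.2.1.add s2.2.1)]
      ring
    have i1 := (Lp.memLp (H2.fn v)).integrable_mul ((hT₁.dirD a).dirD a).memLp
    have i2 := (Lp.memLp (H2.fn v)).integrable_mul ((hT₂.dirD b).dirD b).memLp
    have hint : (∫ x in Ω, H2.fn v x * ψ n x) - ∫ x in Ω, H2.fn v x * ψ (n + 1) x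
        = ε n ^ 2 * (∫ x in Ω, H2.fn v x * dirD a (dirD a (conv f (scale (ε n) Q₁))) x)
          + ε n ^ 2 * ∫ x in Ω, H2.fn v x * dirD b (dirD b (conv f (scale (ε n) Q₂))) x := by
      rw [setIntegral_mul_sub _ (hψ n).memLp (hψ (n + 1)).memLp, ← integral_const_mul,
        ← integral_const_mul]
      refine Eq.trans (integral_congr_ae (ae_of_all _ fun x => ?_))
        (integral_add (i1.const_mul (ε n ^ 2)) (i2.const_mul (ε n ^ 2)))
      simp only [hdiff]
      ring
    rw [hint]
    have hε2 : ε n ^ 2 ≤ (1 / 256) ^ n := by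
      have : ε n ^ 2 = ε₀ ^ 2 * (1 / 256) ^ n := by
        simp only [hεdef, mul_pow, ← pow_mul]
        rw [mul_comm n 2, pow_mul]
        norm_num
      rw [this]
      exact mul_le_of_le_one_left (by positivity) (pow_le_one₀ hε₀.le hε₁)
    -- The second derivatives fall on `v`, so only the `L²` norms of `f * Q` remain, bounded
    -- uniformly in `n`.
    have h1 := abs_setIntegral_dirD_dirD_le v a hT₁
    have h2 := abs_setIntegral_dirD_dirD_le v b hT₂
    refine (abs_add_le _ _).trans ?_
    rw [abs_mul, abs_mul, abs_of_nonneg (sq_nonneg (ε n))]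
    calc _ ≤ (1 / 256) ^ n * (4 * ‖a‖ ^ 2 * ‖v‖ * q Q₁)
          + (1 / 256) ^ n * (4 * ‖b‖ ^ 2 * ‖v‖ * q Q₂) := by
          gcongr
          · exact h1.trans (by gcongr; exact hq hQ₁)
          · exact h2.trans (by gcongr; exact hq hQ₂)
      _ = _ := by ring
  refine ⟨ψ, hψ, A₁ + A₂, by positivity, fun n => (hjet n).trans (by gcongr; linarith),
    fun n v => (hinc n v).trans (by gcongr; linarith), fun g => ?_⟩
  have hfΩ : MemLp f 2 (volume.restrict Ω) := hf.restrict Ω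
  rw [tendsto_iff_norm_sub_tendsto_zero]
  have hlim := ((tendsto_conv_scale hf hk hk1 hε0 hεlim).sqrt).const_mul ‖g‖
  rw [Real.sqrt_zero, mul_zero] at hlim
  refine squeeze_zero (fun _ => norm_nonneg _) (fun n => ?_) hlim
  have hm : MemLp (fun x => ψ n x - f x) 2 := (hψ n).memLp_volume.sub hf
  rw [setIntegral_mul_sub g (hψ n).memLp hfΩ, Real.norm_eq_abs]
  refine (abs_setIntegral_mul_le g (hm.restrict Ω)).trans
    (mul_le_mul_of_nonneg_left (Real.sqrt_le_sqrt ?_) (norm_nonneg _))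
  exact setIntegral_le_integral hm.integrable_sq (ae_of_all _ fun _ => sq_nonneg _)

end

/-! ### Measurability and bounds of the nonlinear flux -/

section

open scoped ContDiff

variable {Ω : Set Plane}

/-- Continuous compactly supported truncations of `arctan`. -/
noncomputable def arctanTrunc (n : ℕ) : C₀(ℝ, ℝ) where
  toFun ξ := Real.arctan ξ * max 0 (1 - |ξ| / (n + 1))
  continuous_toFun := by fun_prop
  zero_at_infty' := by
    refine HasCompactSupport.is_zero_at_infty
      (HasCompactSupport.intro (isCompact_closedBall (0 : ℝ) (n + 1)) fun ξ hξ => ?_)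
    rw [mem_closedBall_zero_iff, not_le, Real.norm_eq_abs] at hξ
    have : 1 ≤ |ξ| / (n + 1) := (one_le_div (by positivity)).2 hξ.le
    rw [max_eq_left (by linarith), mul_zero]

/-- `arctan` is not in `C₀(ℝ)`, so weak measurability does not apply to it directly. Truncations in
`C₀(ℝ)` converge boundedly, and each `π z` has finite variation. -/
lemma aestronglyMeasurable_arctanMean {T : ℝ} {π : ℝ × Plane → SignedMeasure ℝ}
    (h : IsL1WeakMeasureFamily Ω T π) :
    AEStronglyMeasurable (arctanMean π) (volume.restrict (Ioo 0 T ×ˢ Ω)) := by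
  refine aestronglyMeasurable_of_tendsto_ae atTop (fun n => h.1 (arctanTrunc n))
    (ae_of_all _ fun z => ?_)
  have : IsFiniteMeasure (π z).variation := by
    rw [← SignedMeasure.totalVariation_eq_variation]
    infer_instance
  refine VectorMeasure.tendsto_integral_of_dominated_convergence (fun _ => Real.pi / 2)
    (fun n => (arctanTrunc n).continuous.aestronglyMeasurable) (integrable_const _)
    (fun n => ae_of_all _ fun ξ => ?_) (ae_of_all _ fun ξ => ?_)
  · have h1 : |Real.arctan ξ| ≤ Real.pi / 2 :=
      abs_le.2 ⟨(Real.neg_pi_div_two_lt_arctan ξ).le, (Real.arctan_lt_pi_div_two ξ).le⟩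
    have h2 : |max 0 (1 - |ξ| / ((n : ℝ) + 1))| ≤ 1 := by
      rw [abs_of_nonneg (le_max_left _ _)]
      exact max_le zero_le_one (by linarith [show 0 ≤ |ξ| / ((n : ℝ) + 1) by positivity])
    calc ‖arctanTrunc n ξ‖ = |Real.arctan ξ| * |max 0 (1 - |ξ| / ((n : ℝ) + 1))| := abs_mul _ _
      _ ≤ Real.pi / 2 * 1 := by gcongr
      _ = _ := mul_one _
  · have h1 : Tendsto (fun n : ℕ => |ξ| / ((n : ℝ) + 1)) atTop (𝓝 0) :=
      tendsto_const_nhds.div_atTop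
        (tendsto_atTop_add_const_right _ _ tendsto_natCast_atTop_atTop)
    have h2 : Tendsto (fun n : ℕ => max 0 (1 - |ξ| / ((n : ℝ) + 1))) atTop (𝓝 1) := by
      simpa using (tendsto_const_nhds (x := (0 : ℝ))).max (h1.const_sub 1)
    simpa [arctanTrunc] using! h2.const_mul (Real.arctan ξ)

lemma secondCountableTopology_L2 : SecondCountableTopology (L2 Ω) := by
  have : Fact ((2 : ℝ≥0∞) ≠ ⊤) := ⟨by norm_num⟩
  infer_instance

lemma secondCountableTopology_H2 : SecondCountableTopology (H2 Ω) := by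
  have := secondCountableTopology_L2 (Ω := Ω)
  have : SecondCountableTopology (PiLp 2 fun _ : JetIndex => L2 Ω) :=
    (PiLp.homeomorph 2 fun _ : JetIndex => L2 Ω).secondCountableTopology
  exact TopologicalSpace.Subtype.secondCountableTopology _

/-- A bounded, everywhere measurable representative. -/
lemma exists_bounded_representative {α : Type*} [MeasurableSpace α] {m : Measure α} {a : α → ℝ}
    (ha : AEStronglyMeasurable a m) {c : ℝ} (hc : ∀ᵐ z ∂m, |a z| ≤ c) :
    ∃ b : α → ℝ, StronglyMeasurable b ∧ (∀ z, |b z| ≤ max c 0) ∧ a =ᵐ[m] b := by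
  refine ⟨fun z => max (-max c 0) (min (ha.mk a z) (max c 0)),
    stronglyMeasurable_const.sup (ha.stronglyMeasurable_mk.inf stronglyMeasurable_const),
    fun z => ?_, ?_⟩
  · have h0 : 0 ≤ max c 0 := le_max_right _ _
    exact abs_le.2 ⟨le_max_left _ _, max_le (by linarith) (min_le_right _ _)⟩
  · filter_upwards [hc, ha.ae_eq_mk] with z h1 h2
    have h3 := abs_le.1 (h1.trans (le_max_left c 0))
    rw [← h2, min_eq_left h3.2, max_eq_right h3.1]

lemma memLp_of_abs_le_add {h : Plane → ℝ} (hm : AEStronglyMeasurable h (volume.restrict Ω))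
    (p q : L2 Ω) {M : ℝ} (hpq : ∀ᵐ x ∂volume.restrict Ω, |h x| ≤ M * (|p x| + |q x|)) :
    MemLp h 2 (volume.restrict Ω) := by
  refine (((Lp.memLp p).norm.add (Lp.memLp q).norm).const_mul M).mono hm ?_
  filter_upwards [hpq] with x hx
  exact hx.trans (le_abs_self _)

lemma abs_setIntegral_mul_le_of_abs_le_add {h : Plane → ℝ}
    (p q w : L2 Ω) {M : ℝ} (hM : 0 ≤ M)
    (hpq : ∀ᵐ x ∂volume.restrict Ω, |h x| ≤ M * (|p x| + |q x|)) :
    |∫ x in Ω, h x * w x| ≤ M * (‖p‖ + ‖q‖) * ‖w‖ := by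
  have hb : ∀ p : L2 Ω, ∫ x in Ω, |w x| * |p x| ≤ ‖w‖ * ‖p‖ := fun p => by
    have h1 := abs_integral_mul_le_sqrt (Lp.memLp w).abs (Lp.memLp p).abs
    simp only [Pi.abs_apply, sq_abs, ← norm_sq_Lp_two, Real.sqrt_sq (norm_nonneg _)] at h1
    exact (le_abs_self _).trans h1
  have hi : ∀ p : L2 Ω, Integrable (fun x => |w x| * |p x|) (volume.restrict Ω) := fun p =>
    (Lp.memLp w).abs.integrable_mul (Lp.memLp p).abs
  calc |∫ x in Ω, h x * w x| ≤ ∫ x in Ω, |h x * w x| := abs_integral_le_integral_abs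
    _ ≤ ∫ x in Ω, (M * (|w x| * |p x|) + M * (|w x| * |q x|)) := by
        refine integral_mono_of_nonneg (ae_of_all _ fun _ => abs_nonneg _)
          (((hi p).const_mul M).add ((hi q).const_mul M)) ?_
        filter_upwards [hpq] with x hx
        rw [abs_mul]
        nlinarith [abs_nonneg (w x)]
    _ = M * (∫ x in Ω, |w x| * |p x|) + M * ∫ x in Ω, |w x| * |q x| := by
        rw [integral_add ((hi p).const_mul M) ((hi q).const_mul M), integral_const_mul,
          integral_const_mul]
    _ ≤ M * (‖w‖ * ‖p‖) + M * (‖w‖ * ‖q‖) := by gcongr <;> exact hb _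
    _ = _ := by ring

lemma abs_sqrt_add_sq_sub_le (a b c d : ℝ) :
    |√(a ^ 2 + b ^ 2) - √(c ^ 2 + d ^ 2)| ≤ |a - c| + |b - d| := by
  have h := abs_norm_sub_norm_le (!₂[a, b] : Plane) !₂[c, d]
  have e1 : ∀ x y : ℝ, ‖(!₂[x, y] : Plane)‖ = √(x ^ 2 + y ^ 2) := fun x y => by
    simp [EuclideanSpace.norm_eq]
  have e2 : (!₂[a, b] : Plane) - !₂[c, d] = !₂[a - c, b - d] := by
    ext i; fin_cases i <;> simp
  rw [e2, e1, e1, e1] at h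
  refine h.trans (Real.sqrt_le_iff.2 ⟨by positivity, ?_⟩)
  nlinarith [sq_abs (a - c), sq_abs (b - d), mul_nonneg (abs_nonneg (a - c)) (abs_nonneg (b - d))]

lemma H2.abs_gradNorm_le (v : H2 Ω) (x : Plane) :
    |H2.gradNorm v x| ≤ |H2.grad v 0 x| + |H2.grad v 1 x| := by
  simpa [H2.gradNorm] using abs_sqrt_add_sq_sub_le (H2.grad v 0 x) (H2.grad v 1 x) 0 0

lemma H2.abs_gradNorm_sub_le (v v' : H2 Ω) : ∀ᵐ x ∂volume.restrict Ω,
    |H2.gradNorm v x - H2.gradNorm v' x| ≤ |H2.grad (v - v') 0 x| + |H2.grad (v - v') 1 x| := by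
  have h : ∀ i, ∀ᵐ x ∂volume.restrict Ω, H2.grad (v - v') i x = H2.grad v i x - H2.grad v' i x :=
    fun i => Lp.coeFn_sub (H2.grad v i) (H2.grad v' i)
  filter_upwards [h 0, h 1] with x h0 h1
  rw [h0, h1]
  exact abs_sqrt_add_sq_sub_le _ _ _ _

lemma H2.stronglyMeasurable_gradNorm (v : H2 Ω) : StronglyMeasurable (H2.gradNorm v) :=
  Real.continuous_sqrt.comp_stronglyMeasurable
    (((Lp.stronglyMeasurable _).pow 2).add ((Lp.stronglyMeasurable _).pow 2))

lemma H2.norm_lap_le (v : H2 Ω) : ‖H2.lap v‖ ≤ 2 * ‖v‖ :=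
  (norm_add_le _ _).trans (by linarith [H2.norm_hess_le v 0 0, H2.norm_hess_le v 1 1])

section Nonlinear

variable {b : ℝ × Plane → ℝ} {M : ℝ} (w : L2 Ω)

/-- The pairing of the nonlinear flux with a fixed function. -/
noncomputable def flux (b : ℝ × Plane → ℝ) (w : L2 Ω) (v : H2 Ω) (t : ℝ) : ℝ :=
  ∫ x in Ω, b (t, x) * H2.gradNorm v x * w x

lemma abs_flux_le (hM : ∀ z, |b z| ≤ M) (v : H2 Ω) (t : ℝ) :
    |flux b w v t| ≤ 2 * M * ‖v‖ * ‖w‖ := by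
  have hM0 : 0 ≤ M := (abs_nonneg _).trans (hM (0, 0))
  refine (abs_setIntegral_mul_le_of_abs_le_add (H2.grad v 0) (H2.grad v 1) w hM0
    (ae_of_all _ fun x => ?_)).trans ?_
  · rw [abs_mul]
    exact mul_le_mul (hM _) (H2.abs_gradNorm_le v x) (abs_nonneg _) hM0
  · have h := add_le_add (H2.norm_grad_le v 0) (H2.norm_grad_le v 1)
    calc _ ≤ M * (‖v‖ + ‖v‖) * ‖w‖ := by gcongr
      _ = _ := by ring

lemma memLp_flux_integrand (hb : StronglyMeasurable b) (hM : ∀ z, |b z| ≤ M) (v : H2 Ω) (t : ℝ) :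
    MemLp (fun x => b (t, x) * H2.gradNorm v x) 2 (volume.restrict Ω) := by
  have hM0 : 0 ≤ M := (abs_nonneg _).trans (hM (0, 0))
  refine memLp_of_abs_le_add ((hb.comp_measurable measurable_prodMk_left).mul
    (H2.stronglyMeasurable_gradNorm v)).aestronglyMeasurable (H2.grad v 0) (H2.grad v 1) (M := M)
    (ae_of_all _ fun x => ?_)
  rw [abs_mul]
  exact mul_le_mul (hM _) (H2.abs_gradNorm_le v x) (abs_nonneg _) hM0

/-- The Euclidean length is Lipschitz in the gradient and `b` is bounded, so the flux is Lipschitz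
in `v`. -/
lemma continuous_flux (hb : StronglyMeasurable b) (hM : ∀ z, |b z| ≤ M) (t : ℝ) :
    Continuous fun v => flux b w v t := by
  have hM0 : 0 ≤ M := (abs_nonneg _).trans (hM (0, 0))
  have hlip : LipschitzWith (2 * M * ‖w‖).toNNReal fun v => flux b w v t := by
    refine LipschitzWith.of_dist_le_mul fun v v' => ?_
    rw [Real.coe_toNNReal _ (by positivity), Real.dist_eq, dist_eq_norm]
    have hi := fun v => (memLp_flux_integrand hb hM v t).integrable_mul (Lp.memLp w)
    have e : flux b w v t - flux b w v' t
        = ∫ x in Ω, (b (t, x) * (H2.gradNorm v x - H2.gradNorm v' x)) * w x := by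
      refine (integral_sub (hi v) (hi v')).symm.trans (integral_congr_ae (ae_of_all _ fun x => ?_))
      simp only [Pi.mul_apply]
      ring
    rw [e]
    refine (abs_setIntegral_mul_le_of_abs_le_add (H2.grad (v - v') 0) (H2.grad (v - v') 1) w hM0
      ?_).trans ?_
    · filter_upwards [H2.abs_gradNorm_sub_le v v'] with x hx
      rw [abs_mul]
      exact mul_le_mul (hM _) hx (abs_nonneg _) hM0
    · have h := add_le_add (H2.norm_grad_le (v - v') 0) (H2.norm_grad_le (v - v') 1)
      calc _ ≤ M * (‖v - v'‖ + ‖v - v'‖) * ‖w‖ := by gcongr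
        _ = _ := by ring
  exact hlip.continuous

/-- A Carathéodory argument: the flux is continuous in `v` and measurable in `t`, hence jointly
measurable because `H²(Ω)` is separable. This avoids choosing a jointly measurable version of
`∇u(t,x)`. -/
lemma aestronglyMeasurable_flux (hb : StronglyMeasurable b) (hM : ∀ z, |b z| ≤ M)
    {u : ℝ → H2 Ω} {τ : Measure ℝ} (hu : AEStronglyMeasurable u τ) :
    AEStronglyMeasurable (fun t => flux b w (u t) t) τ := by
  borelize ↥(H2 Ω)
  have := secondCountableTopology_H2 (Ω := Ω)
  have h1 : StronglyMeasurable (Function.uncurry fun v : H2 Ω => fun t => flux b w v t) := by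
    refine stronglyMeasurable_uncurry_of_continuous_of_stronglyMeasurable
      (fun t => continuous_flux w hb hM t) fun v => ?_
    exact StronglyMeasurable.integral_prod_right' (ν := volume.restrict Ω)
      (f := fun z : ℝ × Plane => b z * H2.gradNorm v z.2 * w z.2)
      ((hb.mul ((H2.stronglyMeasurable_gradNorm v).comp_measurable measurable_snd)).mul
        ((Lp.stronglyMeasurable w).comp_measurable measurable_snd))
  refine ⟨fun t => flux b w (hu.mk u t) t, ?_, ?_⟩
  · exact h1.comp_measurable (hu.stronglyMeasurable_mk.measurable.prodMk measurable_id)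
  · filter_upwards [hu.ae_eq_mk] with t ht
    rw [ht]

end Nonlinear

end

/-! ### Absolute continuity in time of pairings with test functions -/

section

open scoped ContDiff

/-- Fubini on the triangle `t < s`. -/
lemma integral_tail_mul_eq {T : ℝ} {G η : ℝ → ℝ} (hG : IntegrableOn G (Ioo 0 T))
    (hη : IntegrableOn η (Ioo 0 T)) :
    ∫ t in Ioo 0 T, (∫ s in t..T, η s) * G t = ∫ s in Ioo 0 T, η s * ∫ t in Ioc 0 s, G t := by
  set D : Set (ℝ × ℝ) := {p | p.1 < p.2}
  have hD : MeasurableSet D := measurableSet_lt measurable_fst measurable_snd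
  have hint : Integrable (D.indicator fun p : ℝ × ℝ => G p.1 * η p.2)
      ((volume.restrict (Ioo 0 T)).prod (volume.restrict (Ioo 0 T))) :=
    (hG.mul_prod hη).indicator hD
  have h1 : ∀ t ∈ Ioo 0 T, ∫ s in Ioo 0 T, D.indicator (fun p : ℝ × ℝ => G p.1 * η p.2) (t, s)
      = (∫ s in t..T, η s) * G t := by
    intro t ht
    have e : ∀ s, D.indicator (fun p : ℝ × ℝ => G p.1 * η p.2) (t, s)
        = (Ioi t).indicator (fun s => G t * η s) s := fun s => rfl
    simp_rw [e]
    rw [setIntegral_indicator measurableSet_Ioi, integral_const_mul,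
      intervalIntegral.integral_of_le ht.2.le, mul_comm, integral_Ioc_eq_integral_Ioo]
    have : Ioo 0 T ∩ Ioi t = Ioo t T := by
      ext s
      exact ⟨fun h => ⟨h.2, h.1.2⟩, fun h => ⟨⟨ht.1.trans h.1, h.2⟩, h.1⟩⟩
    rw [this]
  have h2 : ∀ s ∈ Ioo 0 T, ∫ t in Ioo 0 T, D.indicator (fun p : ℝ × ℝ => G p.1 * η p.2) (t, s)
      = η s * ∫ t in Ioc 0 s, G t := by
    intro s hs
    have e : ∀ t, D.indicator (fun p : ℝ × ℝ => G p.1 * η p.2) (t, s)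
        = (Iio s).indicator (fun t => G t * η s) t := fun s => rfl
    simp_rw [e]
    rw [setIntegral_indicator measurableSet_Iio, integral_mul_const, mul_comm,
      integral_Ioc_eq_integral_Ioo]
    have : Ioo 0 T ∩ Iio s = Ioo 0 s := by
      ext t
      exact ⟨fun h => ⟨h.1.1, h.2⟩, fun h => ⟨⟨h.1, h.2.trans hs.2⟩, h.2⟩⟩
    rw [this]
  rw [← setIntegral_congr_fun measurableSet_Ioo h1, ← setIntegral_congr_fun measurableSet_Ioo h2]
  exact integral_integral_swap hint

/-- The weak formulation of `m' = -G`, `m(0) = c` in time. -/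
lemma ae_eq_sub_primitive {T c : ℝ} (hT : 0 < T) {m G : ℝ → ℝ} (hm : IntegrableOn m (Ioo 0 T))
    (hG : IntegrableOn G (Ioo 0 T))
    (h : ∀ η : ℝ → ℝ, ContDiff ℝ ∞ η → HasCompactSupport η →
      -(∫ t in Ioo 0 T, η t * m t) + (∫ s in (0 : ℝ)..T, η s) * c
        = ∫ t in Ioo 0 T, (∫ s in t..T, η s) * G t) :
    ∀ᵐ t ∂volume.restrict (Ioo 0 T), m t = c - ∫ s in Ioc 0 t, G s := by
  have hGc : IntegrableOn G (Icc 0 T) := hG.congr_set_ae Ioo_ae_eq_Icc.symm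
  have hP : IntegrableOn (fun t => ∫ s in Ioc 0 t, G s) (Ioo 0 T) :=
    ((intervalIntegral.continuousOn_primitive hGc).integrableOn_Icc).mono_set Ioo_subset_Icc_self
  have hcint : IntegrableOn (fun _ : ℝ => c) (Ioo 0 T) := integrable_const _
  have hf : IntegrableOn (fun t => m t - (c - ∫ s in Ioc 0 t, G s)) (Ioo 0 T) :=
    hm.sub (hcint.sub hP)
  -- Fundamental lemma of the calculus of variations; here `η` is the derivative of the temporal
  -- test function up to sign, so no regularity of `m` is needed.
  have key := isOpen_Ioo.ae_eq_zero_of_integral_contDiff_smul_eq_zero (μ := volume)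
    (hf.locallyIntegrableOn.mono_set subset_rfl) fun η hη hηs hηT => ?_
  · rw [ae_restrict_iff' measurableSet_Ioo]
    filter_upwards [key] with t ht hmem
    exact sub_eq_zero.1 (ht hmem)
  · have hηi : IntegrableOn η (Ioo 0 T) :=
      (hη.continuous.integrable_of_hasCompactSupport hηs).integrableOn
    obtain ⟨B, hB⟩ := hη.continuous.bounded_above_of_compact_support hηs
    have hmul : ∀ {g : ℝ → ℝ}, IntegrableOn g (Ioo 0 T) →
        IntegrableOn (fun t => η t * g t) (Ioo 0 T) := fun hg =>
      hg.bdd_mul hη.continuous.aestronglyMeasurable (ae_of_all _ hB)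
    have h1 := h η hη hηs
    rw [integral_tail_mul_eq hG hηi, intervalIntegral.integral_of_le hT.le,
      integral_Ioc_eq_integral_Ioo, ← integral_mul_const] at h1
    have e1 : ∫ t, η t • (m t - (c - ∫ s in Ioc 0 t, G s))
        = ∫ t in Ioo 0 T, η t * (m t - (c - ∫ s in Ioc 0 t, G s)) :=
      (setIntegral_eq_integral_of_forall_compl_eq_zero fun t ht => by
        rw [image_eq_zero_of_notMem_tsupport fun h => ht (hηT h), zero_smul]).symm
    have e2 : ∫ t in Ioo 0 T, η t * (m t - (c - ∫ s in Ioc 0 t, G s))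
        = (∫ t in Ioo 0 T, η t * m t) - (∫ t in Ioo 0 T, η t * c)
          + ∫ t in Ioo 0 T, η t * ∫ s in Ioc 0 t, G s := by
      rw [← integral_sub (hmul hm) (hmul hcint)]
      refine Eq.trans (integral_congr_ae (ae_of_all _ fun t => ?_))
        (integral_add ((hmul hm).sub (hmul hcint)) (hmul hP))
      beta_reduce
      ring
    rw [e1, e2]
    linarith

variable {Ω D₀ : Set Plane} {T ν μ lam0 : ℝ} {u₀ : L2 Ω} {u : ℝ → H2 Ω}
  {π : ℝ × Plane → SignedMeasure ℝ}

lemma setIntegral_mul_smul_coe (c : ℝ) (w : L2 Ω) (g : Plane → ℝ) :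
    ∫ x in Ω, g x * (c • w : L2 Ω) x = c * ∫ x in Ω, g x * w x := by
  rw [← integral_const_mul]
  refine integral_congr_ae ?_
  filter_upwards [Lp.coeFn_smul c w] with x hx
  rw [hx, Pi.smul_apply, smul_eq_mul]
  ring

lemma H2.lap_smul (c : ℝ) (v : H2 Ω) : H2.lap (c • v) = c • H2.lap v :=
  (smul_add c (H2.hess v 0 0) (H2.hess v 1 1)).symm

lemma smul_jet_mem_H20 {ψ : Plane → ℝ} (hψ : IsTestFunction Ω ψ) (c : ℝ) :
    c • jet hψ ∈ H20 Ω := by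
  refine subset_closure ⟨fun x => c * ψ x, hψ.const_mul c, ?_⟩
  filter_upwards [Lp.coeFn_smul c (H2.fn (jet hψ)), fn_jet hψ] with x h1 h2
  exact h1.trans (by rw [Pi.smul_apply, h2, smul_eq_mul])

lemma abs_tail_sub_le {η : ℝ → ℝ} (hη : Continuous η) {B : ℝ} (hB : ∀ s, ‖η s‖ ≤ B) (T t s : ℝ) :
    |(∫ r in t..T, η r) - ∫ r in s..T, η r| ≤ B * |t - s| := by
  have hi := fun a b => hη.intervalIntegrable (μ := volume) a b
  have h := intervalIntegral.integral_add_adjacent_intervals (hi s t) (hi t T)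
  have e : (∫ r in t..T, η r) - ∫ r in s..T, η r = -∫ r in s..t, η r := by linarith
  rw [e, abs_neg]
  exact intervalIntegral.norm_integral_le_of_norm_le_const fun r _ => hB r

/-- Separated test functions are admissible. -/
lemma isAdmissibleTest_tail_smul {ψ : Plane → ℝ} (hψ : IsTestFunction Ω ψ) {η : ℝ → ℝ}
    (hη : Continuous η) (hηs : HasCompactSupport η) (T : ℝ) :
    IsAdmissibleTest Ω T fun t => (∫ s in t..T, η s) • jet hψ := by
  obtain ⟨B, hB⟩ := hη.bounded_above_of_compact_support hηs
  have hB0 : 0 ≤ B := (norm_nonneg _).trans (hB 0)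
  refine ⟨⟨(B * ‖jet hψ‖).toNNReal, LipschitzOnWith.of_dist_le_mul fun t _ s _ => ?_⟩,
    fun t _ => smul_jet_mem_H20 hψ _, by simp⟩
  rw [Real.coe_toNNReal _ (by positivity), dist_eq_norm, ← sub_smul, norm_smul, Real.norm_eq_abs,
    Real.dist_eq]
  calc _ ≤ B * |t - s| * ‖jet hψ‖ := by gcongr; exact abs_tail_sub_le hη hB T t s
    _ = _ := by ring

lemma deriv_tail_smul {η : ℝ → ℝ} (hη : Continuous η) (T t : ℝ) (v : H2 Ω) :
    deriv (fun t => (∫ s in t..T, η s) • v) t = (-η t) • v := by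
  have h : HasDerivAt (fun t => ∫ s in t..T, η s) (-η t) t :=
    intervalIntegral.integral_hasDerivAt_left (hη.intervalIntegrable _ _)
      (hη.stronglyMeasurableAtFilter _ _) hη.continuousAt
  exact (h.smul_const v).deriv

/-- The weak formulation, tested with separated functions. -/
lemma IsYoungSolution.weak_form_separated (hu : IsYoungSolution Ω D₀ T ν μ lam0 u₀ u π)
    {ψ : Plane → ℝ} (hψ : IsTestFunction Ω ψ) {η : ℝ → ℝ} (hη : Continuous η)
    (hηs : HasCompactSupport η) :
    -(∫ t in Ioo 0 T, η t * ∫ x in Ω, H2.fn (u t) x * H2.fn (jet hψ) x)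
        + (∫ s in (0 : ℝ)..T, η s) * ∫ x in Ω, u₀ x * H2.fn (jet hψ) x
      = (∫ t in Ioo 0 T, (∫ s in t..T, η s) * ∫ x in Ω,
          (ν * arctanMean π (t, x) * H2.gradNorm (u t) x + μ * H2.lap (u t) x)
            * H2.lap (jet hψ) x)
        - ∫ t in Ioo 0 T, (∫ s in t..T, η s) * ∫ x in Ω,
            fidelity lam0 D₀ x * (u₀ x - H2.fn (u t) x) * H2.fn (jet hψ) x := by
  -- The tail `∫_t^T η` vanishes at `T`, has derivative `-η`, and takes the value `∫_0^T η` at `0`,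
  -- which brings in `u₀`.
  have h := hu.weak_form _ (isAdmissibleTest_tail_smul hψ hη hηs T)
  simp only [deriv_tail_smul hη, H2.lap_smul] at h
  have hfn : ∀ (c : ℝ), H2.fn (c • jet hψ) = c • H2.fn (jet hψ) := fun c => rfl
  simp only [hfn, setIntegral_mul_smul_coe, neg_mul, integral_neg] at h
  exact h

/-- The zeroth order term. -/
noncomputable def fidelityTerm (lam0 : ℝ) (D₀ : Set Plane) (u₀ w v : L2 Ω) : ℝ :=
  ∫ x in Ω, fidelity lam0 D₀ x * (u₀ x - v x) * w x

lemma memLp_fidelity_mul (hD : MeasurableSet D₀) (lam0 : ℝ) (w : L2 Ω) :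
    MemLp (fun x => fidelity lam0 D₀ x * w x) 2 (volume.restrict Ω) := by
  classical
  have hm : Measurable (fidelity lam0 D₀) := by
    have : fidelity lam0 D₀ = fun x => if x ∈ D₀ then 0 else lam0 := by
      ext x
      simp only [fidelity]
    rw [this]
    exact Measurable.ite hD measurable_const measurable_const
  refine (Lp.memLp w).of_le_mul (c := |lam0|)
    (hm.aestronglyMeasurable.mul (Lp.aestronglyMeasurable _)) (ae_of_all _ fun x => ?_)
  rw [norm_mul]
  gcongr
  unfold fidelity
  split_ifs <;> simp

lemma fidelityTerm_eq (hD : MeasurableSet D₀) (u₀ w v : L2 Ω) :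
    fidelityTerm lam0 D₀ u₀ w v = inner ℝ ((memLp_fidelity_mul hD lam0 w).toLp _) (u₀ - v) := by
  rw [L2.inner_def]
  refine integral_congr_ae ?_
  filter_upwards [(memLp_fidelity_mul hD lam0 w).coeFn_toLp, Lp.coeFn_sub u₀ v] with x h1 h2
  rw [h1, h2]
  simp
  ring

lemma norm_fidelity_mul_le (hD : MeasurableSet D₀) (lam0 : ℝ) (w : L2 Ω) :
    ‖(memLp_fidelity_mul hD lam0 w).toLp _‖ ≤ |lam0| * ‖w‖ := by
  refine Lp.norm_le_mul_norm_of_ae_le_mul ?_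
  filter_upwards [(memLp_fidelity_mul hD lam0 w).coeFn_toLp] with x h1
  rw [h1, norm_mul]
  gcongr
  unfold fidelity
  split_ifs <;> simp

/-- Along a solution, pairings with a test function are absolutely continuous in time. -/
lemma IsYoungSolution.exists_primitive (hD : MeasurableSet D₀) (hT : 0 < T)
    (hu : IsYoungSolution Ω D₀ T ν μ lam0 u₀ u π) :
    ∃ C, 0 ≤ C ∧ ∀ (ψ : Plane → ℝ) (hψ : IsTestFunction Ω ψ), ∃ G : ℝ → ℝ,
      IntegrableOn G (Ioo 0 T) ∧
      (∀ᵐ t ∂volume.restrict (Ioo 0 T), |G t| ≤ C * ‖jet hψ‖ * (‖u t‖ + 1)) ∧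
      ∀ᵐ t ∂volume.restrict (Ioo 0 T),
        ∫ x in Ω, H2.fn (u t) x * ψ x = (∫ x in Ω, u₀ x * ψ x) - ∫ s in Ioc 0 t, G s := by
  obtain ⟨c, hc⟩ := hu.arctan_bound
  -- A version of the mean that is measurable and bounded everywhere, so that every time slice can
  -- be used without exceptional sets.
  obtain ⟨b, hb, hbM, hab⟩ := exists_bounded_representative
    (aestronglyMeasurable_arctanMean hu.young) hc
  set M := max c 0
  have hM0 : 0 ≤ M := le_max_right _ _
  have habt : ∀ᵐ t ∂volume.restrict (Ioo 0 T), ∀ᵐ x ∂volume.restrict Ω,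
      arctanMean π (t, x) = b (t, x) := by
    rw [Measure.volume_eq_prod, ← Measure.prod_restrict] at hab
    exact Measure.ae_ae_of_ae_prod hab
  have hum : AEStronglyMeasurable u (volume.restrict (Ioo 0 T)) := hu.memLp.1
  have hui : Integrable (fun t => ‖u t‖ + 1) (volume.restrict (Ioo 0 T)) :=
    (hu.memLp.integrable (by norm_num)).norm.add (integrable_const _)
  have hfnc : Continuous (H2.fn : H2 Ω → L2 Ω) :=
    (PiLp.continuous_apply 2 _ _).comp continuous_subtype_val
  have hlapc : Continuous (H2.lap : H2 Ω → L2 Ω) :=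
    ((PiLp.continuous_apply 2 _ _).comp continuous_subtype_val).add
      ((PiLp.continuous_apply 2 _ _).comp continuous_subtype_val)
  -- The constant does not depend on `ψ`, which enters only through `‖jet hψ‖`. The factors `4` come
  -- from `‖Δv‖ ≤ 2 ‖v‖` and the two components of the gradient.
  refine ⟨|ν| * (4 * M) + |μ| * 4 + |lam0| * (‖u₀‖ + 1), by positivity, fun ψ hψ => ?_⟩
  set J := jet hψ
  set R₁ : ℝ → ℝ := fun t => ν * flux b (H2.lap J) (u t) t
    + μ * inner ℝ (H2.lap J) (H2.lap (u t)) with hR₁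
  set R₂ : ℝ → ℝ := fun t => fidelityTerm lam0 D₀ u₀ (H2.fn J) (H2.fn (u t)) with hR₂
  have hR₁b : ∀ t, |R₁ t| ≤ (|ν| * (4 * M) + |μ| * 4) * ‖J‖ * ‖u t‖ := by
    intro t
    have h1 := abs_flux_le (H2.lap J) hbM (u t) t
    have h2 := abs_real_inner_le_norm (H2.lap J) (H2.lap (u t))
    have h3 := H2.norm_lap_le J
    have h4 := H2.norm_lap_le (u t)
    refine (abs_add_le _ _).trans ?_
    rw [abs_mul, abs_mul]
    calc _ ≤ |ν| * (2 * M * ‖u t‖ * (2 * ‖J‖)) + |μ| * ((2 * ‖J‖) * (2 * ‖u t‖)) := by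
          gcongr
          · exact h1.trans (by gcongr)
          · exact h2.trans (by gcongr)
      _ = _ := by ring
  have hR₂b : ∀ t, |R₂ t| ≤ |lam0| * (‖u₀‖ + 1) * ‖J‖ * (‖u t‖ + 1) := by
    intro t
    simp only [hR₂, fidelityTerm_eq hD]
    have h1 : ‖u₀ - H2.fn (u t)‖ ≤ ‖u₀‖ + ‖u t‖ :=
      (norm_sub_le _ _).trans (by gcongr; exact H2.norm_fn_le _)
    have h2 := (norm_fidelity_mul_le hD lam0 (H2.fn J)).trans
      (mul_le_mul_of_nonneg_left (H2.norm_fn_le J) (abs_nonneg _))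
    refine (abs_real_inner_le_norm _ _).trans ?_
    calc _ ≤ |lam0| * ‖J‖ * (‖u₀‖ + ‖u t‖) := by gcongr
      _ ≤ |lam0| * ‖J‖ * ((‖u₀‖ + 1) * (‖u t‖ + 1)) := by
          gcongr
          nlinarith [norm_nonneg u₀, norm_nonneg (u t)]
      _ = _ := by ring
  have hR₁m : AEStronglyMeasurable R₁ (volume.restrict (Ioo 0 T)) :=
    ((aestronglyMeasurable_flux _ hb hbM hum).const_mul ν).add
      (((continuous_const.inner hlapc).comp_aestronglyMeasurable hum).const_mul μ)
  have hR₂m : AEStronglyMeasurable R₂ (volume.restrict (Ioo 0 T)) := by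
    simp only [hR₂, fidelityTerm_eq hD]
    exact (continuous_const.inner (continuous_const.sub hfnc)).comp_aestronglyMeasurable hum
  have hR₁i : IntegrableOn R₁ (Ioo 0 T) :=
    Integrable.mono' (hui.const_mul ((|ν| * (4 * M) + |μ| * 4) * ‖J‖)) hR₁m
      (ae_of_all _ fun t => (hR₁b t).trans (by gcongr; linarith))
  have hR₂i : IntegrableOn R₂ (Ioo 0 T) :=
    Integrable.mono' (hui.const_mul _) hR₂m (ae_of_all _ hR₂b)
  have hpair : ∀ g : L2 Ω, ∫ x in Ω, g x * H2.fn J x = ∫ x in Ω, g x * ψ x := fun g =>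
    integral_congr_ae (by filter_upwards [fn_jet hψ] with x hx; rw [hx])
  have hmi : IntegrableOn (fun t => ∫ x in Ω, H2.fn (u t) x * H2.fn J x) (Ioo 0 T) := by
    have e : ∀ t, ∫ x in Ω, H2.fn (u t) x * H2.fn J x = inner ℝ (H2.fn J) (H2.fn (u t)) :=
      fun t => by rw [L2.inner_def]; rfl
    simp only [e]
    refine Integrable.mono' (hui.const_mul ‖J‖)
      ((continuous_const.inner hfnc).comp_aestronglyMeasurable hum) (ae_of_all _ fun t => ?_)
    refine (abs_real_inner_le_norm _ _).trans ?_
    have h1 := H2.norm_fn_le J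
    have h2 := H2.norm_fn_le (u t)
    gcongr
    linarith
  refine ⟨fun t => R₁ t - R₂ t, hR₁i.sub hR₂i, ae_of_all _ fun t => ?_, ?_⟩
  · refine (abs_sub _ _).trans ?_
    have h1 : (|ν| * (4 * M) + |μ| * 4) * ‖J‖ * ‖u t‖
        ≤ (|ν| * (4 * M) + |μ| * 4) * ‖J‖ * (‖u t‖ + 1) := by gcongr; linarith
    have h2 := hR₁b t
    have h3 := hR₂b t
    nlinarith
  · have key := ae_eq_sub_primitive (c := ∫ x in Ω, u₀ x * H2.fn J x) hT hmi (hR₁i.sub hR₂i)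
      fun η hη hηs => ?_
    · simpa only [hpair] using! key
    rw [hu.weak_form_separated hψ hη.continuous hηs]
    have e1 : ∫ t in Ioo 0 T, (∫ s in t..T, η s) * ∫ x in Ω,
          (ν * arctanMean π (t, x) * H2.gradNorm (u t) x + μ * H2.lap (u t) x) * H2.lap J x
        = ∫ t in Ioo 0 T, (∫ s in t..T, η s) * R₁ t := by
      refine integral_congr_ae ?_
      filter_upwards [habt] with t ht
      congr 1
      have i1 := (memLp_flux_integrand hb hbM (u t) t).integrable_mul (Lp.memLp (H2.lap J))
      have i2 := (Lp.memLp (H2.lap (u t))).integrable_mul (Lp.memLp (H2.lap J))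
      have e2 : inner ℝ (H2.lap J) (H2.lap (u t)) = ∫ x in Ω, H2.lap (u t) x * H2.lap J x := by
        rw [L2.inner_def]; rfl
      simp only [hR₁, flux]
      rw [e2, ← integral_const_mul, ← integral_const_mul]
      refine Eq.trans (integral_congr_ae ?_) (integral_add (i1.const_mul ν) (i2.const_mul μ))
      filter_upwards [ht] with x hx
      simp only [hx]
      ring
    obtain ⟨B, hB⟩ := hη.continuous.bounded_above_of_compact_support hηs
    have hθc : Continuous fun t => ∫ s in t..T, η s := by
      have : LipschitzWith B.toNNReal fun t => ∫ s in t..T, η s :=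
        LipschitzWith.of_dist_le_mul fun t s => by
          rw [Real.coe_toNNReal _ ((norm_nonneg _).trans (hB 0)), Real.dist_eq, Real.dist_eq]
          exact abs_tail_sub_le hη.continuous hB T t s
      exact this.continuous
    obtain ⟨A, hA⟩ := isCompact_Icc.exists_bound_of_continuousOn (s := Icc (0 : ℝ) T)
      hθc.continuousOn
    have hmul : ∀ {g : ℝ → ℝ}, IntegrableOn g (Ioo 0 T) →
        IntegrableOn (fun t => (∫ s in t..T, η s) * g t) (Ioo 0 T) := fun hg =>
      hg.bdd_mul hθc.aestronglyMeasurable (c := A) (by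
        filter_upwards [ae_restrict_mem measurableSet_Ioo] with t ht
        exact hA t (Ioo_subset_Icc_self ht))
    rw [e1]
    refine (integral_sub (hmul hR₁i) (hmul hR₂i)).symm.trans
      (integral_congr_ae (ae_of_all _ fun t => ?_))
    exact (mul_sub _ _ _).symm

end

/-! ### Cone condition and localisation -/

section

open scoped ContDiff Convolution Pointwise

variable {Ω : Set Plane}

/-- Coordinates of the plane whose positive quadrant is the cone `K |y₀| < y₁`, up to opening. -/
noncomputable def coneCoord (e : Plane ≃ₗᵢ[ℝ] Plane) (K : ℝ≥0) : Plane ≃L[ℝ] ℝ × ℝ :=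
  LinearEquiv.toContinuousLinearEquiv
    { toFun := fun z => (e z 1 / (K + 1) + e z 0, e z 1 / (K + 1) - e z 0)
      map_add' := fun z w => by ext <;> simp <;> ring
      map_smul' := fun c z => by ext <;> simp <;> ring
      invFun := fun p => e.symm !₂[(p.1 - p.2) / 2, (K + 1) * ((p.1 + p.2) / 2)]
      left_inv := fun z => by
        have hK : (K + 1 : ℝ) ≠ 0 := by positivity
        rw [LinearIsometryEquiv.symm_apply_eq]
        ext i
        fin_cases i
        · simp
        · simp; field_simp
      right_inv := fun p => by
        have hK : (K + 1 : ℝ) ≠ 0 := by positivity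
        ext <;> simp <;> field_simp <;> ring }

/-- The slope `K + 1` in place of `K` covers `K = 0` too. The strict inequality is what moves
boundary points into the open set. -/
lemma mul_abs_lt_of_mem_openCone {e : Plane ≃ₗᵢ[ℝ] Plane} {K : ℝ≥0} {z : Plane}
    (hz : z ∈ openCone (coneCoord e K)) : K * |e z 0| < e z 1 := by
  obtain ⟨h1, h2⟩ := hz
  replace h1 : 0 < e z 1 / (K + 1) + e z 0 := h1
  replace h2 : 0 < e z 1 / (K + 1) - e z 0 := h2
  have hK : (0 : ℝ) < K + 1 := by positivity
  have h : |e z 0| < e z 1 / (K + 1) := abs_lt.2 ⟨by linarith, by linarith⟩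
  rw [lt_div_iff₀ hK] at h
  nlinarith [abs_nonneg (e z 0)]

/-- The uniform cone condition at a point of the closure of a Lipschitz domain. -/
lemma HasLipschitzBoundary.exists_openCone (hΩ : IsOpen Ω) (h : HasLipschitzBoundary Ω) {p : Plane}
    (hp : p ∈ closure Ω) : ∃ r > 0, ∃ e : Plane ≃L[ℝ] ℝ × ℝ, ∃ ρ > 0,
      ∀ x ∈ closure Ω ∩ Metric.ball p r, ∀ z ∈ openCone e, ‖z‖ < ρ → x + z ∈ Ω := by
  by_cases hpΩ : p ∈ Ω
  · obtain ⟨r, hr, hb⟩ := Metric.isOpen_iff.1 hΩ p hpΩ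
    -- At an interior point any cone will do.
    refine ⟨r / 2, half_pos hr, coneCoord (LinearIsometryEquiv.refl ℝ _) 0, r / 2, half_pos hr,
      fun x hx z _ hz => hb ?_⟩
    have h1 : dist x p < r / 2 := hx.2
    rw [Metric.mem_ball]
    calc dist (x + z) p ≤ dist (x + z) x + dist x p := dist_triangle _ _ _
      _ < r := by rw [dist_self_add_left]; linarith
  · obtain ⟨r, hr, e, γ, K, hγ, hrep⟩ := h p (by rw [hΩ.frontier_eq]; exact ⟨hp, hpΩ⟩)
    refine ⟨r / 2, half_pos hr, coneCoord e K, r / 2, half_pos hr, fun x hx z hz hzr => ?_⟩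
    have h1 : dist x p < r / 2 := hx.2
    -- Points of the closure satisfy the graph inequality only weakly; the displacement by `z`
    -- restores strictness.
    have hle : γ (e x 0) ≤ e x 1 := by
      have hcl : x ∈ closure (Ω ∩ Metric.ball p r) :=
        Metric.isOpen_ball.closure_inter ⟨hx.1, by rw [Metric.mem_ball]; linarith⟩
      have hc : IsClosed {y : Plane | γ (e y 0) ≤ e y 1} := by
        have := hγ.continuous
        exact isClosed_le (by fun_prop) (by fun_prop)
      refine closure_minimal (fun y hy => ?_) hc hcl
      rw [hrep] at hy
      exact hy.2.le
    have hmem : x + z ∈ Ω ∩ Metric.ball p r := by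
      rw [hrep]
      refine ⟨?_, ?_⟩
      · rw [Metric.mem_ball]
        calc dist (x + z) p ≤ dist (x + z) x + dist x p := dist_triangle _ _ _
          _ < r := by rw [dist_self_add_left]; linarith
      · have h2 := hγ.dist_le_mul (e (x + z) 0) (e x 0)
        rw [Real.dist_eq, Real.dist_eq] at h2
        have h3 := mul_abs_lt_of_mem_openCone hz
        have h4 := (le_abs_self _).trans h2
        simp only [map_add, PiLp.add_apply, add_sub_cancel_left] at h4 ⊢
        linarith
    exact hmem.1

/-- The weak initial trace, tested with a cut-off of `φ` localised where a cone condition holds. -/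
lemma IsYoungSolution.essLimAtZero_cutoff {D₀ : Set Plane} {T ν μ lam0 : ℝ} {u₀ : L2 Ω}
    {u : ℝ → H2 Ω} {π : ℝ × Plane → SignedMeasure ℝ} (hΩ : MeasurableSet Ω)
    (hD : MeasurableSet D₀) (hT : 0 < T) (hu : IsYoungSolution Ω D₀ T ν μ lam0 u₀ u π)
    {χ : Plane → ℝ} (hχ : IsTestFunction univ χ) {e : Plane ≃L[ℝ] ℝ × ℝ} {ρ : ℝ} (hρ : 0 < ρ)
    (hcone : ∀ x ∈ closure Ω ∩ tsupport χ, ∀ z ∈ openCone e, ‖z‖ < ρ → x + z ∈ Ω) (φ : H2 Ω) :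
    EssLimAtZero (fun t => ∫ x in Ω, H2.fn (u t) x * cutoff χ φ x)
      (∫ x in Ω, u₀ x * cutoff χ φ x) := by
  obtain ⟨B, hB0, hB⟩ := exists_abs_integral_cutoff_dirD_le hΩ hχ φ
  have hsupp : Function.support (cutoff χ φ) ⊆ closure Ω ∩ tsupport χ := fun x hx => by
    have hxΩ : x ∈ Ω := by
      by_contra hn
      exact hx (indicator_of_notMem hn _)
    refine ⟨subset_closure hxΩ, subset_tsupport _ fun h0 => hx ?_⟩
    simp [cutoff, h0]
  obtain ⟨ψ, hψ, A, hA0, hjet, hstep, hlim⟩ := exists_approx (memLp_cutoff hΩ hχ φ)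
    (hχ.2.1.isCompact.inter_left isClosed_closure) hsupp hρ hcone hB0 hB
  obtain ⟨C, hC0, hC⟩ := hu.exists_primitive hD hT
  choose G hG hGb hGe using fun n => hC (ψ n) (hψ n)
  have hr : volume.restrict (Ioo 0 T) = volume.restrict (Ioc 0 T) :=
    Measure.restrict_congr_set Ioo_ae_eq_Ioc
  have hint : ∀ n, IntegrableOn (G n) (Ioc 0 T) := fun n => by
    rw [IntegrableOn, ← hr]; exact hG n
  rw [hr] at hGb hGe
  -- `C * A + A` serves both as the bound `C * A` on the derivatives and as the bound `A` on the
  -- increments.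
  refine essLimAtZero_of_approx hT (g := fun t => ‖u t‖ + 1)
    (M := fun n t => ∫ x in Ω, H2.fn (u t) x * ψ n x) (G := G)
    (c := fun n => ∫ x in Ω, u₀ x * ψ n x) (C := C * A + A) (by positivity) ?_ hint
    (fun n => ?_) hGe (fun n => ae_of_all _ fun t => ?_) (ae_of_all _ fun t => hlim _) (hlim _)
  · have := hu.memLp
    rw [hr] at this
    exact this.norm.add (memLp_const 1)
  · filter_upwards [hGb n] with t ht
    rw [abs_of_nonneg (by positivity : 0 ≤ ‖u t‖ + 1)]
    refine ht.trans (mul_le_mul_of_nonneg_right ?_ (by positivity))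
    calc C * ‖jet (hψ n)‖ ≤ C * (A * 64 ^ n) := by gcongr; exact hjet n
      _ ≤ (C * A + A) * 64 ^ n := by
        have : 0 ≤ A * 64 ^ n := by positivity
        linarith
  · rw [abs_of_nonneg (by positivity : 0 ≤ ‖u t‖ + 1)]
    refine (hstep n (u t)).trans ?_
    gcongr
    · have : 0 ≤ C * A := by positivity
      linarith
    · linarith

/-- A finite smooth partition of unity on a compact set, subordinate to given neighbourhoods. -/
lemma exists_finite_testFunction_sum_eq_one {S : Set Plane} (hS : IsCompact S) {r : Plane → ℝ}
    (hr : ∀ p ∈ S, 0 < r p) : ∃ (ι : Finset Plane) (χ : ι → Plane → ℝ),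
      (∀ i, i.1 ∈ S ∧ IsTestFunction univ (χ i) ∧ tsupport (χ i) ⊆ Metric.ball i.1 (r i)) ∧
      ∀ x ∈ S, ∑ i, χ i x = 1 := by
  obtain ⟨ι, hι, hcov⟩ := hS.elim_nhds_subcover (fun p => Metric.ball p (r p))
    fun p hp => Metric.ball_mem_nhds p (hr p hp)
  obtain ⟨f, hf⟩ := SmoothPartitionOfUnity.exists_isSubordinate (modelWithCornersSelf ℝ Plane)
    hS.isClosed (fun i : ι => Metric.ball i.1 (r i)) (fun _ => Metric.isOpen_ball)
    fun x hx => by simpa using hcov hx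
  refine ⟨ι, fun i => f i, fun i => ⟨hι i i.2, ⟨?_, ?_, subset_univ _⟩, hf i⟩, fun x hx => ?_⟩
  · exact (f i).contMDiff.contDiff
  · exact HasCompactSupport.of_support_subset_isCompact (isCompact_closedBall i.1 (r i))
      ((subset_tsupport _).trans ((hf i).trans Metric.ball_subset_closedBall))
  · rw [← finsum_eq_sum_of_fintype]
    exact f.sum_eq_one hx

end

end ShockFilterCH

open ShockFilterCH in
theorem mainTheorem5
    (Ω : Set Plane) (hΩ_open : IsOpen Ω) (hΩ_bdd : Bornology.IsBounded Ω)
    (hΩ_lip : HasLipschitzBoundary Ω)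
    (ω : Set Plane) (hω_meas : MeasurableSet ω) (hω_sub : ω ⊆ Ω)
    (T ν μ lam0 : ℝ) (hT : 0 < T) (hν : 0 < ν) (hμ : 0 < μ) (hlam0 : 0 < lam0)
    (u₀ : L2 Ω) (u : ℝ → H2 Ω) (π : ℝ × Plane → SignedMeasure ℝ)
    (hu : IsYoungSolution Ω ω T ν μ lam0 u₀ u π)
    (φ : H2 Ω) :
    EssLimAtZero (fun t => ∫ x in Ω, H2.fn (u t) x * H2.fn φ x) (∫ x in Ω, u₀ x * H2.fn φ x) := by
  have hΩ := hΩ_open.measurableSet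
  choose! r hr e ρ hρ hcone using fun p (hp : p ∈ closure Ω) =>
    hΩ_lip.exists_openCone hΩ_open hp
  obtain ⟨ι, χ, hχ, hsum⟩ := exists_finite_testFunction_sum_eq_one hΩ_bdd.isCompact_closure hr
  -- The claim is linear in `φ`, and the cutoffs of `φ` sum to `φ` on `Ω`; each lives where a single
  -- cone works.
  have hsplit : ∀ g : L2 Ω,
      ∫ x in Ω, g x * H2.fn φ x = ∑ i, ∫ x in Ω, g x * cutoff (χ i) φ x := fun g => by
    have hi : ∀ i, Integrable (fun x => g x * cutoff (χ i) φ x) (volume.restrict Ω) := fun i =>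
      (Lp.memLp g).integrable_mul ((memLp_cutoff hΩ (hχ i).2.1 φ).restrict Ω)
    rw [← integral_finsetSum _ fun i _ => hi i]
    refine setIntegral_congr_fun hΩ fun x hx => ?_
    simp only [cutoff, indicator_of_mem hx]
    rw [← Finset.mul_sum, ← Finset.sum_mul, hsum x (subset_closure hx), one_mul]
  simp only [hsplit]
  exact tendsto_finsetSum _ fun i _ => hu.essLimAtZero_cutoff hΩ hω_meas hT (hχ i).2.1
    (hρ i (hχ i).1) (fun x hx => hcone i (hχ i).1 x ⟨hx.1, (hχ i).2.2 hx.2⟩) φ
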